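/- **Setting.** Let $q\ge 1$ and let $\mathcal T$ be a homogeneous tree of order $q$ (an acyclic connected graph in which every node belongs to exactly $q+1$ edges). Fix a boundary point $\infty_{\mathcal T}$ of $\mathcal T$, i.e. an equivalence class of infinite non-backtracking paths, two paths being equivalent if they coincide modulo a finite number of edges. Every node is the starting point of exactly one representative of $\infty_{\mathcal T}$; let $s\wedge t$ be the node at which the representatives starting at $s$ and $t$ first meet. Write $s\preceq t$ if $\operatorname{dist}(s,s\wedge t)\le\operatorname{dist}(t,s\wedge t)$, and $s\asymp t$ if equality holds. Fix maps $\alpha_1,\dots,\alpha_q:\mathcal T\to\mathcal T$, acting on the right, with $\{t\alpha_1,\dots,t\alpha_q\}=\{s: t\preceq s,\ \operatorname{dist}(t,s)=1\}$ for every $t$, and denote by the same letters the operators $(\alpha_jf)(t)=f(t\alpha_j)$ on $\ell_2(\mathcal T)$ (complex valued). Words $w=\alpha_{i_1}\cdots\alpha_{i_n}$, of length $|w|=n$, act on nodes and as operators accordingly. Let $\chi_t$ be the standard basis vectors. A bounded operator $S$ on $\ell_2(\mathcal T)$ is *causal* if for every node $s$ and every $f\in\ell_2(\mathcal T)$ vanishing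 at all $t\preceq s$, $Sf$ also vanishes at all $t\preceq s$. Let $\mathcal C$ be the algebra of bounded operators $S$ such that $S$ and $S^*$ are causal, and let $\mathcal C_2$ be the set of $F\in\mathcal C$ with $\sum_t\|F\chi_t\|^2<\infty$. Put $\langle F,G\rangle_2=\operatorname{trace}(G^*F)$. For $c=(c_1,\dots,c_q)\in\mathcal C^q$ let $c\alpha=\sum_j c_j\alpha_j$, and let $$\mathbb B(\mathcal T)=\{c\in\mathcal C^q:\ \lim_{n\to\infty}\|(c\alpha)^n\|^{1/n}<1\}.$$ For a causal $S$ and a word $w$ let $S_{[w]}\in\mathcal C$ be given by $(S_{[w]}\chi_t)(s)=(S\chi_t)(sw)$ if $t\asymp s$ and $0$ otherwise. The *point evaluation* of $S$ at $c\in\mathbb B(\mathcal T)$ is $$S^\wedge(c)=\sum_{n=0}^\infty(c\alpha)^n\Big(\sum_{|w|=n}w^*S_{[w]}\Big)$$ (convergence in operator norm). A *Schur multiplier* is a causal operator $S$ with $\|S\|\le1$. **Theorem.** Let a map $s:\mathbb B(\mathcal T)\to\mathcal C$ be given. For all $c,d\in\mathbb B(\mathcal T)$ the series $$K_s(c,d)=\sum_{n=0}^\infty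 (c\alpha)^n\,(I-s(c)s(d)^*)\,(d\alpha)^{n*}$$ converges absolutely in operator norm to an element of $\mathcal C$. There exists a Schur multiplier $S$ with $s(c)=S^\wedge(c)$ for all $c\in\mathbb B(\mathcal T)$ if and only if the kernel $K_s$ is positive, i.e. for all $m\ge0$, $c_0,\dots,c_m\in\mathbb B(\mathcal T)$ and $k_0,\dots,k_m\in\mathcal C_2$, $$\sum_{i,j=0}^m\langle K_s(c_i,c_j)k_j,k_i\rangle_2\ \ge 0 .$$ In this case, for every such $S$ and all $c,d\in\mathbb B(\mathcal T)$, the operator $I-(d\alpha)^*$ is invertible, the operator $K_S^d=(I-S\,S^\wedge(d)^*)\,K_\wedge^d$ with $K_\wedge^d=(I-(d\alpha)^*)^{-1}$ is causal, and $K_s(c,d)=(K_S^d)^\wedge(c)$. -/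

import Mathlib

open scoped ComplexOrder

/-- An infinite path in the graph `G` without backtracking: consecutive nodes are joined by an
edge and consecutive edges are distinct. -/
structure GraphRay {V : Type*} (G : SimpleGraph V) where
  node : ℕ → V
  adj : ∀ k, G.Adj (node k) (node (k + 1))
  ne : ∀ k, node k ≠ node (k + 2)

namespace GraphRay

variable {V : Type*} {G : SimpleGraph V}

/-- The path `p`, after its first `m` edges, coincides with the path `r` after its first `n`
edges. -/
def Coincide (p r : GraphRay G) (m n : ℕ) : Prop := ∀ k, p.node (m + k) = r.node (n + k)

/-- `m` and `n` are the minimal indices for which the two paths coincide. -/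
def MinCoincide (p r : GraphRay G) (m n : ℕ) : Prop :=
  Coincide p r m n ∧ ∀ m' n', Coincide p r m' n' → m ≤ m' ∧ n ≤ n'

/-- Two paths are equivalent if they coincide modulo a finite number of edges. -/
def setoid (G : SimpleGraph V) : Setoid (GraphRay G) where
  r p r := ∃ m n, Coincide p r m n
  iseqv :=
    { refl := fun _ => ⟨0, 0, fun _ => rfl⟩
      symm := fun ⟨m, n, h⟩ => ⟨n, m, fun k => (h k).symm⟩
      trans := by
        rintro p r u ⟨m, n, h⟩ ⟨m', n', h'⟩
        refine ⟨m + m', n' + n, fun k => ?_⟩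
        have h1 := h (m' + k)
        have h2 := h' (n + k)
        rw [show m + m' + k = m + (m' + k) by ring, h1,
          show n + (m' + k) = m' + (n + k) by ring, h2,
          show n' + n + k = n' + (n + k) by ring] }

theorem ext_node {p r : GraphRay G} (h : ∀ k, p.node k = r.node k) : p = r := by
  cases p; cases r
  congr
  exact funext h

/-- Put one more node in front of a path. -/
def cons (p : GraphRay G) (v : V) (hv : G.Adj v (p.node 0)) (hne : v ≠ p.node 1) :
    GraphRay G where
  node k := match k with
    | 0 => v
    | k + 1 => p.node k
  adj k := match k with
    | 0 => hv
    | k + 1 => p.adj k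
  ne k := match k with
    | 0 => hne
    | k + 1 => p.ne k

/-- Remove the first node of a path. -/
def tail (p : GraphRay G) : GraphRay G where
  node k := p.node (k + 1)
  adj k := p.adj (k + 1)
  ne k := p.ne (k + 1)

end GraphRay

/-- Boundary points of a graph: equivalence classes of infinite paths. -/
def GraphBoundary {V : Type*} (G : SimpleGraph V) : Type _ := Quotient (GraphRay.setoid G)

/-- The boundary point represented by a path. -/
def GraphRay.toBoundary {V : Type*} {G : SimpleGraph V} (p : GraphRay G) : GraphBoundary G :=
  Quotient.mk (GraphRay.setoid G) p

namespace GraphBoundary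

variable {V : Type*} {G : SimpleGraph V}

/-- `x` is the node `s ∧ t`: the node where the representatives of the boundary point `ω`
starting at `s` and at `t` first meet. -/
def IsMeet (ω : GraphBoundary G) (s t x : V) : Prop :=
  ∃ p r : GraphRay G, p.toBoundary = ω ∧ r.toBoundary = ω ∧ p.node 0 = s ∧ r.node 0 = t ∧
    ∃ m n, GraphRay.MinCoincide p r m n ∧ p.node m = x

/-- The ordering `s ⪯ t`, that is, `dist (s, s ∧ t) ≤ dist (t, s ∧ t)`. -/
def Prec (ω : GraphBoundary G) (s t : V) : Prop :=
  ∃ x, ω.IsMeet s t x ∧ G.dist s x ≤ G.dist t x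

/-- The relation `s ≍ t`, that is, `dist (s, s ∧ t) = dist (t, s ∧ t)`. -/
def Asymp (ω : GraphBoundary G) (s t : V) : Prop :=
  ∃ x, ω.IsMeet s t x ∧ G.dist s x = G.dist t x

end GraphBoundary

/-- A homogeneous tree of order `q` with the set `V` of nodes (an acyclic connected graph, each
node of which belongs to exactly `q + 1` edges), together with a choice of a boundary point and a
choice of primitive shifts `t ↦ t α_j`. -/
structure OrientedTree (V : Type*) (q : ℕ) where
  graph : SimpleGraph V
  isTree : graph.IsTree
  degree : ∀ t, (graph.neighborSet t).encard = q + 1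
  infty : GraphBoundary graph
  shift : Fin q → V → V
  range_shift : ∀ t, Set.range (fun j => shift j t) =
    {s | infty.Prec t s ∧ graph.dist t s = 1}

/-! ### Elementary geometry of the tree -/

namespace GraphRay

variable {V : Type*} {G : SimpleGraph V}

theorem closer_unique (hG : G.IsTree) {u v a b : V} (ha : G.Adj a v) (hb : G.Adj b v)
    (hda : G.dist u v = G.dist u a + 1) (hdb : G.dist u v = G.dist u b + 1) : a = b := by
  obtain ⟨P, -, hP⟩ := hG.connected.exists_path_of_dist u a
  obtain ⟨Q, -, hQ⟩ := hG.connected.exists_path_of_dist u b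
  have h1 : (P.concat ha).IsPath :=
    SimpleGraph.Walk.isPath_of_length_eq_dist _ (by simp [hP, hda])
  have h2 : (Q.concat hb).IsPath :=
    SimpleGraph.Walk.isPath_of_length_eq_dist _ (by simp [hQ, hdb])
  have h3 := (hG.existsUnique_path u v).unique h1 h2
  have h4 := congrArg SimpleGraph.Walk.penultimate h3
  simpa using h4

theorem dist_node (hG : G.IsTree) (p : GraphRay G) (n : ℕ) :
    G.dist (p.node 0) (p.node n) = n := by
  induction n using Nat.strong_induction_on with
  | _ n ih =>
    match n with
    | 0 => simp
    | 1 => exact SimpleGraph.dist_eq_one_iff_adj.2 (p.adj 0)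
    | n + 2 =>
      have h0 := ih n (by omega)
      have h1 := ih (n + 1) (by omega)
      rcases hG.isAcyclic.dist_eq_dist_add_one_of_adj_of_reachable (p.node 0) (p.adj (n + 1))
        (hG.connected (p.node 0) (p.node (n + 1))) with h | h
      · exact absurd (closer_unique hG (p.adj n) (p.adj (n + 1)).symm (by omega) h) (p.ne n)
      · rw [h, h1]

theorem node_injective (hG : G.IsTree) (p : GraphRay G) : Function.Injective p.node := by
  intro a b h
  have ha := dist_node hG p a
  rw [h, dist_node hG p b] at ha
  exact ha.symm

/-- A boundary point of a tree has at most one representative starting at a given node. -/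
theorem eq_of_toBoundary (hG : G.IsTree) {p r : GraphRay G} (h0 : p.node 0 = r.node 0)
    (h : p.toBoundary = r.toBoundary) : p = r := by
  obtain ⟨m, n, hmn⟩ := Quotient.exact h
  have h1 := hmn 0
  have hm := dist_node hG p m
  have hn := dist_node hG r n
  simp only [add_zero] at h1
  rw [h1, h0, hn] at hm
  subst hm
  have key : ∀ k, k ≤ n → p.node (n - k) = r.node (n - k) := by
    intro k
    induction k with
    | zero => intro _; simpa using h1
    | succ k ih =>
      intro hk
      have h2 := ih (by omega)
      have ha := p.adj (n - (k + 1))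
      have hb := r.adj (n - (k + 1))
      rw [show n - (k + 1) + 1 = n - k by omega] at ha hb
      rw [← h2] at hb
      have d1 := dist_node hG p (n - k)
      have d2 := dist_node hG p (n - (k + 1))
      have d3 := dist_node hG r (n - (k + 1))
      rw [← h0] at d3
      exact closer_unique hG (u := p.node 0) ha hb (by omega) (by omega)
  refine ext_node fun k => ?_
  rcases le_total k n with hk | hk
  · have := key (n - k) (by omega)
    rwa [show n - (n - k) = k by omega] at this
  · have := hmn (k - n)
    rwa [show n + (k - n) = k by omega] at this

/-- A boundary point of a tree has a representative starting at any given node. -/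
theorem exists_toBoundary (hG : G.IsTree) (ω : GraphBoundary G) (t : V) :
    ∃ p : GraphRay G, p.toBoundary = ω ∧ p.node 0 = t := by
  obtain ⟨ρ, rfl⟩ : ∃ ρ : GraphRay G, ρ.toBoundary = ω := Quotient.exists_rep ω
  obtain ⟨W⟩ := hG.connected t (ρ.node 0)
  suffices H : ∀ (a b : V) (_ : G.Walk a b),
      (∃ p : GraphRay G, p.toBoundary = ρ.toBoundary ∧ p.node 0 = b) →
      ∃ p : GraphRay G, p.toBoundary = ρ.toBoundary ∧ p.node 0 = a from
    H _ _ W ⟨ρ, rfl, rfl⟩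
  intro a b W
  induction W with
  | nil => exact id
  | @cons u v w huv _ ih =>
    intro h
    obtain ⟨p, hp, hp0⟩ := ih h
    by_cases hu : u = p.node 1
    · exact ⟨p.tail, (Quotient.sound ⟨0, 1, fun k => by simp [tail, add_comm]⟩ :
        p.tail.toBoundary = p.toBoundary).trans hp, hu.symm⟩
    · refine ⟨p.cons u (hp0 ▸ huv) hu, (Quotient.sound ⟨1, 0, fun k => ?_⟩ :
        _ = p.toBoundary).trans hp, rfl⟩
      rw [add_comm 1 k, zero_add]
      rfl

end GraphRay

namespace GraphBoundary

variable {V : Type*} {G : SimpleGraph V}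

theorem asymp_iff (hG : G.IsTree) (ω : GraphBoundary G) (s t : V) :
    ω.Asymp s t ↔ ∃ p r : GraphRay G, p.toBoundary = ω ∧ r.toBoundary = ω ∧ p.node 0 = s ∧
      r.node 0 = t ∧ ∃ m, GraphRay.Coincide p r m m := by
  constructor
  · rintro ⟨x, ⟨p, r, hp, hr, rfl, rfl, m, n, hmn, rfl⟩, hd⟩
    refine ⟨p, r, hp, hr, rfl, rfl, m, ?_⟩
    have h1 : p.node m = r.node n := by simpa using hmn.1 0
    rw [GraphRay.dist_node hG, h1, GraphRay.dist_node hG] at hd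
    subst hd
    exact hmn.1
  · rintro ⟨p, r, hp, hr, rfl, rfl, hm⟩
    classical
    have hspec := Nat.find_spec hm
    have hmin : ∀ m', GraphRay.Coincide p r m' m' → Nat.find hm ≤ m' := fun m' h =>
      Nat.find_min' hm h
    generalize Nat.find hm = m at hspec hmin
    refine ⟨p.node m, ⟨p, r, hp, hr, rfl, rfl, m, m, ⟨hspec, fun m' n' h => ?_⟩, rfl⟩, ?_⟩
    · have h1 := h m
      have h2 := hspec m'
      rw [add_comm m m', h1] at h2
      have h3 := GraphRay.node_injective hG r h2
      have h4 : m' = n' := by omega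
      subst h4
      exact ⟨hmin _ h, hmin _ h⟩
    · have h1 : p.node m = r.node m := by simpa using hspec 0
      rw [GraphRay.dist_node hG, h1, GraphRay.dist_node hG]

theorem asymp_equivalence (hG : G.IsTree) (ω : GraphBoundary G) : Equivalence ω.Asymp := by
  refine ⟨fun s => ?_, fun {s t} h => ?_, fun {s t u} h h' => ?_⟩
  · obtain ⟨p, hp, h0⟩ := GraphRay.exists_toBoundary hG ω s
    exact (asymp_iff hG ω s s).2 ⟨p, p, hp, hp, h0, h0, 0, fun _ => rfl⟩
  · obtain ⟨p, r, hp, hr, h0, h0', m, hm⟩ := (asymp_iff hG ω s t).1 h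
    exact (asymp_iff hG ω t s).2 ⟨r, p, hr, hp, h0', h0, m, fun k => (hm k).symm⟩
  · obtain ⟨p, r, hp, hr, h0, h0', m, hm⟩ := (asymp_iff hG ω s t).1 h
    obtain ⟨p', r', hp', hr', h1, h1', m', hm'⟩ := (asymp_iff hG ω t u).1 h'
    obtain rfl : r = p' :=
      GraphRay.eq_of_toBoundary hG (h0'.trans h1.symm) (hr.trans hp'.symm)
    refine (asymp_iff hG ω s u).2 ⟨p, r', hp, hr', h0, h1', m + m', fun k => ?_⟩
    have e1 := hm (m' + k)
    have e2 := hm' (m + k)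
    rw [← add_assoc] at e1
    rw [e1, show m + m' + k = m' + (m + k) by ring, e2]

/-- A node of a tree has only one neighbour that precedes it. -/
theorem parent_unique (hG : G.IsTree) (ω : GraphBoundary G) {t t' x : V}
    (h : ω.Prec t x ∧ G.dist t x = 1) (h' : ω.Prec t' x ∧ G.dist t' x = 1) : t = t' := by
  obtain ⟨r, hr, hr0⟩ := GraphRay.exists_toBoundary hG ω x
  have key : ∀ a, ω.Prec a x → G.dist a x = 1 → a = r.node 1 := by
    rintro a ⟨y, ⟨p, r', hp, hr', rfl, hr0', m, n, hmn, rfl⟩, hd⟩ h1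
    obtain rfl : r = r' := GraphRay.eq_of_toBoundary hG (hr0.trans hr0'.symm) (hr.trans hr'.symm)
    by_contra hne
    have hadj : G.Adj (p.node 0) x := SimpleGraph.dist_eq_one_iff_adj.1 h1
    rw [← hr0] at hadj
    have hc : (r.cons _ hadj hne).toBoundary = r.toBoundary :=
      Quotient.sound ⟨1, 0, fun k => by rw [add_comm 1 k, zero_add]; rfl⟩
    have hpc : p = r.cons _ hadj hne :=
      GraphRay.eq_of_toBoundary hG rfl (hp.trans (hr.symm.trans hc.symm))
    have hco : GraphRay.Coincide p r 1 0 := fun k => by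
      rw [add_comm 1 k, zero_add, hpc]; rfl
    have hn : n = 0 := Nat.le_zero.1 (hmn.2 _ _ hco).2
    subst hn
    have h2 : p.node m = r.node 0 := by simpa using hmn.1 0
    rw [h2, hr0, SimpleGraph.dist_self, h1] at hd
    omega
  rw [key t h.1 h.2, key t' h'.1 h'.2]

end GraphBoundary

/-! ### Operators on the Hilbert space of square summable functions on the tree -/

/-- The Hilbert space `ℓ₂(V)`. -/
abbrev TreeL2 (V : Type*) : Type _ := lp (fun _ : V => ℂ) 2

/-- The C*-algebra of bounded operators on `ℓ₂(V)`; `*` is composition, `star` the adjoint. -/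
abbrev TreeOp (V : Type*) : Type _ := TreeL2 V →L[ℂ] TreeL2 V

namespace TreeL2

variable {V : Type*}

open Classical in
/-- The standard basis vector `χ_t`. -/
noncomputable def basisVec (t : V) : TreeL2 V := lp.single 2 t 1

theorem norm_sq (f : TreeL2 V) : ‖f‖ ^ 2 = ∑' t, ‖f t‖ ^ 2 := by
  have := lp.norm_rpow_eq_tsum (p := 2) (by norm_num) f
  simpa using this

theorem summable_sq (f : TreeL2 V) : Summable fun t => ‖f t‖ ^ 2 := by
  have := (lp.memℓp f).summable (p := 2) (by norm_num)
  simpa using this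

theorem memLp_of_sum_le {f : V → ℂ} {C : ℝ} (h : ∀ F : Finset V, ∑ t ∈ F, ‖f t‖ ^ 2 ≤ C) :
    Memℓp (fun t => f t) 2 :=
  memℓp_gen' (C := C) (by simpa using h)

theorem norm_le_of_sum_le {f : TreeL2 V} {C : ℝ} (hC : 0 ≤ C)
    (h : ∀ F : Finset V, ∑ t ∈ F, ‖f t‖ ^ 2 ≤ C ^ 2) : ‖f‖ ≤ C :=
  lp.norm_le_of_forall_sum_le (p := 2) (by norm_num) hC (by simpa using h)

theorem sum_comp_le {a : V → V} (ha : Function.Injective a) (f : TreeL2 V) (F : Finset V) :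
    ∑ t ∈ F, ‖f (a t)‖ ^ 2 ≤ ‖f‖ ^ 2 := by
  rw [norm_sq]
  calc ∑ t ∈ F, ‖f (a t)‖ ^ 2 = ∑ t ∈ F.map ⟨a, ha⟩, ‖f t‖ ^ 2 := by simp
    _ ≤ _ := (summable_sq f).sum_le_tsum _ fun _ _ => by positivity

/-- The operator `f ↦ f ∘ a` for an injective map `a`. -/
noncomputable def compOp (a : V → V) (ha : Function.Injective a) : TreeOp V :=
  LinearMap.mkContinuous
    { toFun := fun f => ⟨fun t => f (a t), memLp_of_sum_le (sum_comp_le ha f)⟩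
      map_add' := fun _ _ => rfl
      map_smul' := fun _ _ => rfl } 1 fun f => by
    rw [one_mul]
    exact norm_le_of_sum_le (norm_nonneg f) (sum_comp_le ha f)

theorem compOp_apply (a : V → V) (ha : Function.Injective a) (f : TreeL2 V) (t : V) :
    compOp a ha f t = f (a t) := rfl

theorem sum_indicator_le (A : Set V) (f : TreeL2 V) (F : Finset V) :
    ∑ t ∈ F, ‖A.indicator f t‖ ^ 2 ≤ ‖f‖ ^ 2 := by
  rw [norm_sq]
  refine le_trans (Finset.sum_le_sum fun t _ => ?_)
    ((summable_sq f).sum_le_tsum F fun _ _ => by positivity)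
  gcongr
  exact norm_indicator_le_norm_self f t

/-- The orthogonal projection onto the functions supported in `A`. -/
noncomputable def proj (A : Set V) : TreeOp V :=
  LinearMap.mkContinuous
    { toFun := fun f => ⟨A.indicator f, memLp_of_sum_le (sum_indicator_le A f)⟩
      map_add' := fun f g => lp.ext (Set.indicator_add A f g)
      map_smul' := fun c f => lp.ext (Set.indicator_const_smul A c f) } 1 fun f => by
    rw [one_mul]
    exact norm_le_of_sum_le (norm_nonneg f) (sum_indicator_le A f)

theorem proj_apply (A : Set V) (f : TreeL2 V) (t : V) : proj A f t = A.indicator f t := rfl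

theorem sum_norm_proj_le (r : Setoid V) (f : TreeL2 V) (H : Finset (Quotient r)) :
    ∑ h ∈ H, ‖proj {t | Quotient.mk r t = h} f‖ ^ 2 ≤ ‖f‖ ^ 2 := by
  classical
  simp only [norm_sq]
  rw [← Summable.tsum_finsetSum fun h _ => summable_sq _]
  refine Summable.tsum_le_tsum (fun t => ?_) (summable_sum fun h _ => summable_sq _)
    (summable_sq f)
  have : ∀ h ∈ H, ‖proj {t | Quotient.mk r t = h} f t‖ ^ 2 =
      if h = Quotient.mk r t then ‖f t‖ ^ 2 else 0 := by
    intro h _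
    rw [proj_apply]
    by_cases e : Quotient.mk r t = h
    · simp [e]
    · simp [e, Ne.symm e]
  rw [Finset.sum_congr rfl this, Finset.sum_ite_eq']
  split_ifs
  · exact le_rfl
  · positivity

theorem sum_blockDiag_le (r : Setoid V) (A : TreeOp V) (f : TreeL2 V) (F : Finset V) :
    ∑ s ∈ F, ‖A (proj {t | r t s} f) s‖ ^ 2 ≤ (‖A‖ * ‖f‖) ^ 2 := by
  classical
  have hset : ∀ s, {t | r t s} = {t | Quotient.mk r t = Quotient.mk r s} := fun s => by
    ext t; exact Quotient.eq.symm
  simp only [hset]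
  rw [← Finset.sum_fiberwise_of_maps_to (g := Quotient.mk r) (t := F.image (Quotient.mk r))
    fun s hs => Finset.mem_image_of_mem _ hs]
  calc _ ≤ ∑ h ∈ F.image (Quotient.mk r), ‖A (proj {t | Quotient.mk r t = h} f)‖ ^ 2 := by
        refine Finset.sum_le_sum fun h _ => ?_
        rw [norm_sq]
        refine le_trans (le_of_eq (Finset.sum_congr rfl fun s hs => ?_))
          ((summable_sq (A (proj {t | Quotient.mk r t = h} f))).sum_le_tsum
            (F.filter fun s => Quotient.mk r s = h) fun _ _ => by positivity)
        rw [(Finset.mem_filter.1 hs).2]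
    _ ≤ ∑ h ∈ F.image (Quotient.mk r),
          ‖A‖ ^ 2 * ‖proj {t | Quotient.mk r t = h} f‖ ^ 2 := by
        refine Finset.sum_le_sum fun h _ => ?_
        rw [← mul_pow]
        gcongr
        exact A.le_opNorm _
    _ ≤ (‖A‖ * ‖f‖) ^ 2 := by
        rw [← Finset.mul_sum, mul_pow]
        gcongr
        exact sum_norm_proj_le r f _

/-- The block diagonal part of `A` with respect to the classes of the equivalence relation `r`:
the operator with the matrix entries `(A χ_t)(s)` if `t` is equivalent to `s`, and `0`
otherwise. -/
noncomputable def blockDiag (r : Setoid V) (A : TreeOp V) : TreeOp V :=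
  LinearMap.mkContinuous
    { toFun := fun f => ⟨fun s => A (proj {t | r t s} f) s,
        memLp_of_sum_le (sum_blockDiag_le r A f)⟩
      map_add' := fun f g => lp.ext <| funext fun s => by
        simp only [map_add, lp.coeFn_add, Pi.add_apply]
      map_smul' := fun c f => lp.ext <| funext fun s => by simp } ‖A‖ fun f =>
    norm_le_of_sum_le (by positivity) (sum_blockDiag_le r A f)

theorem blockDiag_apply (r : Setoid V) (A : TreeOp V) (f : TreeL2 V) (s : V) :
    blockDiag r A f s = A (proj {t | r t s} f) s := rfl

open Classical in
theorem blockDiag_basisVec (r : Setoid V) (A : TreeOp V) (t s : V) :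
    blockDiag r A (basisVec t) s = if r t s then A (basisVec t) s else 0 := by
  have hp : proj {t | r t s} (basisVec t) = if r t s then basisVec t else 0 := by
    refine lp.ext (funext fun u => ?_)
    rw [proj_apply]
    by_cases hu : u = t
    · subst hu
      by_cases h : r u s <;> simp [h]
    · have h0 : basisVec t u = 0 := lp.single_apply_ne 2 t 1 hu
      by_cases h : r t s <;> simp [h, h0, Set.indicator_apply]
  rw [blockDiag_apply, hp]
  split_ifs <;> simp

end TreeL2

namespace OrientedTree

variable {V : Type*} {q : ℕ} (T : OrientedTree V q)

theorem shift_injective (j : Fin q) : Function.Injective (T.shift j) := by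
  intro t t' h
  have hm : ∀ u, T.shift j u ∈ {s | T.infty.Prec u s ∧ T.graph.dist u s = 1} := fun u => by
    rw [← T.range_shift u]
    exact ⟨j, rfl⟩
  have h1 := hm t
  have h2 := hm t'
  rw [← h] at h2
  exact GraphBoundary.parent_unique T.isTree T.infty h1 h2

/-- The primitive shift `α_j` as an operator: `(α_j f)(t) = f (t α_j)`. -/
noncomputable def shiftOp (j : Fin q) : TreeOp V :=
  TreeL2.compOp (T.shift j) (T.shift_injective j)

/-- The right action of the word `w = α_{i₁} ⋯ α_{iₙ}` on nodes: `t ↦ t α_{i₁} ⋯ α_{iₙ}`. -/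
def wordShift (w : List (Fin q)) (t : V) : V := w.foldl (fun u j => T.shift j u) t

/-- The operator `α_{i₁} ⋯ α_{iₙ}` defined by the word `w = α_{i₁} ⋯ α_{iₙ}`. -/
noncomputable def wordOp (w : List (Fin q)) : TreeOp V := (w.map T.shiftOp).prod

theorem wordOp_apply (w : List (Fin q)) (f : TreeL2 V) (t : V) :
    T.wordOp w f t = f (T.wordShift w t) := by
  induction w generalizing t with
  | nil => simp [wordOp, wordShift]
  | cons j w ih =>
    have h : T.wordOp (j :: w) f t = T.wordOp w f (T.shift j t) := by
      simp [wordOp, shiftOp, TreeL2.compOp_apply]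
    rw [h, ih]
    rfl

/-- The horocycle equivalence relation `≍`. -/
def horocycle : Setoid V := ⟨T.infty.Asymp, GraphBoundary.asymp_equivalence T.isTree T.infty⟩

/-- The algebra of causal operators. -/
def causal : Set (TreeOp V) :=
  {S | ∀ (s : V) (f : TreeL2 V), (∀ t, T.infty.Prec t s → f t = 0) →
    ∀ t, T.infty.Prec t s → S f t = 0}

/-- The algebra of constants: operators that are causal together with their adjoints. -/
def constants : Set (TreeOp V) := {S | S ∈ T.causal ∧ star S ∈ T.causal}

/-- The coefficients `S_[w]` of the expansion `S = ∑ w^* S_[w]` of a causal operator `S`; see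
`taylorCoeff_basisVec`. -/
noncomputable def taylorCoeff (S : TreeOp V) (w : List (Fin q)) : TreeOp V :=
  TreeL2.blockDiag T.horocycle (T.wordOp w * S)

open Classical in
/-- `(S_[w] χ_t)(s)` is `(S χ_t)(s w)` if `t ≍ s`, and `0` otherwise. -/
theorem taylorCoeff_basisVec (S : TreeOp V) (w : List (Fin q)) (t s : V) :
    T.taylorCoeff S w (TreeL2.basisVec t) s =
      if T.infty.Asymp t s then S (TreeL2.basisVec t) (T.wordShift w s) else 0 := by
  rw [taylorCoeff, TreeL2.blockDiag_basisVec]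
  simp only [mul_apply_eq_comp, wordOp_apply]
  rfl

/-- The operator `c α = c₁ α₁ + ⋯ + c_q α_q`. -/
noncomputable def rowShift (c : Fin q → TreeOp V) : TreeOp V := ∑ j, c j * T.shiftOp j

/-- The unit ball: the `q`-tuples `c` of constants for which the limit of `‖(c α)^n‖^(1/n)` is
less than `1`. -/
def ball : Set (Fin q → TreeOp V) :=
  {c | (∀ j, c j ∈ T.constants) ∧ ∃ ρ : ℝ, ρ < 1 ∧
    Filter.Tendsto (fun n : ℕ => ‖T.rowShift c ^ n‖ ^ (1 / (n : ℝ))) Filter.atTop (nhds ρ)}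

/-- The homogeneous part `∑_{|w| = n} w^* S_[w]` of a causal operator. -/
noncomputable def homogPart (S : TreeOp V) (n : ℕ) : TreeOp V :=
  ∑ w : Fin n → Fin q, star (T.wordOp (List.ofFn w)) * T.taylorCoeff S (List.ofFn w)

/-- The point evaluation `S^∧(c) = ∑ₙ (c α)^n (∑_{|w| = n} w^* S_[w])`, the series being taken in
the operator norm. -/
noncomputable def pointEval (S : TreeOp V) (c : Fin q → TreeOp V) : TreeOp V :=
  ∑' n : ℕ, T.rowShift c ^ n * T.homogPart S n

/-- The Hilbert–Schmidt inner product `⟨F, G⟩₂ = trace (G^* F)`, linear in `F`. -/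
noncomputable def hsInner (F G : TreeOp V) : ℂ :=
  ∑' t : V, inner ℂ (G (TreeL2.basisVec t)) (F (TreeL2.basisVec t))

/-- The space `C₂` of constants of finite Hilbert–Schmidt norm. -/
def constantsHS : Set (TreeOp V) :=
  {F | F ∈ T.constants ∧ Summable fun t : V => ‖F (TreeL2.basisVec t)‖ ^ 2}

/-- Schur multipliers: causal contractions. -/
def schurMultipliers : Set (TreeOp V) := {S | S ∈ T.causal ∧ ‖S‖ ≤ 1}

/-- The terms `(c α)^n (I - s(c) s(d)^*) (d α)^{n*}` of the series for the kernel `K_s`. -/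
noncomputable def kernelTerm (s : T.ball → T.constants) (c d : T.ball) (n : ℕ) : TreeOp V :=
  T.rowShift c ^ n * (1 - (s c : TreeOp V) * star (s d : TreeOp V)) * star (T.rowShift d ^ n)

/-- The kernel `K_s(c, d)`, the series being taken in the operator norm. -/
noncomputable def kernel (s : T.ball → T.constants) (c d : T.ball) : TreeOp V :=
  ∑' n : ℕ, T.kernelTerm s c d n

/-- Positivity of an operator valued kernel on the ball. Here `0 ≤ z` for a complex number `z`
means that `z` is real and nonnegative. -/
def IsPositiveKernel (K : T.ball → T.ball → TreeOp V) : Prop :=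
  ∀ (m : ℕ) (c : Fin (m + 1) → T.ball) (k : Fin (m + 1) → T.constantsHS),
    0 ≤ ∑ i, ∑ j, hsInner (K (c i) (c j) * (k j : TreeOp V)) (k i : TreeOp V)

/-- The operator `K_∧^d = (I - α^* d^*)^{-1}`. -/
noncomputable def cauchyKernel (d : Fin q → TreeOp V) : TreeOp V :=
  Ring.inverse (1 - star (T.rowShift d))

/-- The operator `K_S^d = (I - S S^∧(d)^*) K_∧^d`. -/
noncomputable def schurKernel (S : TreeOp V) (d : Fin q → TreeOp V) : TreeOp V :=
  (1 - S * star (T.pointEval S d)) * T.cauchyKernel d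

end OrientedTree

/-! ### The level function of an oriented tree -/

namespace GraphRay

variable {V : Type*} {G : SimpleGraph V}

/-! The nodes carry an integer level that grows away from the distinguished boundary point, and
`Prec` just compares levels. Causal operators are those preserving each space of functions supported
on levels `≥ n`; constants are block diagonal for the levels (`mem_constants`), and `c α` lowers the
degree by one. With `R_c = (I - c α)⁻¹` and `diagPart` the block diagonal part, degree counting
gives `S^∧(c) = diagPart (R_c S)` (`pointEval_eq`) and `K_s(c, d) = diagPart (R_c (I - s(c) s(d)^*)
R_d^*)` (`kernel_eq`).

The engine is `levelProj_resolvent_mul_levelProjGE`: for causal `S`, the operators `R_c S` and `R_c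
S^∧(c)` agree from levels `≥ k` into level `k`. It yields the formula for `K_s` as a point
evaluation. Its adjoint is the analogue of the classical fact that the adjoint of a multiplier acts
on kernel functions by conjugate values: for `v` on level `n`, the part of `S^* R_c^* v` on levels
`≥ n` is `S^∧(c)^* R_c^* v`.

Restricted to one level, the kernel form is a difference of two squared norms (`sum_inner_kernel`).
Since an element of `C₂` sends `χ_t` to a vector on the level of `t`, and since rank one operators
realise every such vector, positivity of `K_s` says exactly that `‖∑ s(c_i)^* R_{c_i}^* v_i‖ ≤ ‖∑
R_{c_i}^* v_i‖` whenever all `v_i` lie on a common level. For a Schur multiplier this holds because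
`S^*` is a contraction.

Conversely, for each `n` the inequality defines a contraction `A_n` with `R_c^* v ↦ s(c)^* R_c^* v`
for `v` on level `n`, and zero below that level (`exists_contraction`). It is everywhere defined
since the vectors `R_c^* v` span a dense subspace of the functions on levels `≥ n`; explicit
geometric series along paths isolate each basis vector (`basisVec_mem_of_star_resolvent_mem`). By
this density the adjoints `A_n^*` are restrictions of one another, so they glue to a single causal
contraction `S` (`exists_schurMultiplier`). -/

theorem Coincide.sub_eq (hG : G.IsTree) {p r : GraphRay G} {m n m' n' : ℕ}
    (h : Coincide p r m n) (h' : Coincide p r m' n') : (m : ℤ) - n = m' - n' := by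
  have h1 := h m'
  have h2 := h' m
  rw [add_comm m' m, h1] at h2
  have := node_injective hG r h2
  omega

/-- The difference of the two indices is the same for every coincidence, so minimising the first
index also minimises the second. -/
theorem Coincide.exists_min (hG : G.IsTree) {p r : GraphRay G} {m n : ℕ}
    (h : Coincide p r m n) : ∃ m' n', MinCoincide p r m' n' := by
  classical
  have hex : ∃ m, ∃ n, Coincide p r m n := ⟨m, n, h⟩
  obtain ⟨n', hn'⟩ := Nat.find_spec hex
  refine ⟨Nat.find hex, n', hn', fun a b hab => ?_⟩
  have h1 : Nat.find hex ≤ a := Nat.find_min' hex ⟨b, hab⟩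
  have h2 := hn'.sub_eq hG hab
  omega

end GraphRay

namespace OrientedTree

variable {V : Type*} {q : ℕ} (T : OrientedTree V q)

/-- The representative of the distinguished boundary point that starts at the node `t`. -/
noncomputable def ray (t : V) : GraphRay T.graph :=
  (GraphRay.exists_toBoundary T.isTree T.infty t).choose

theorem ray_toBoundary (t : V) : (T.ray t).toBoundary = T.infty :=
  (GraphRay.exists_toBoundary T.isTree T.infty t).choose_spec.1

theorem ray_zero (t : V) : (T.ray t).node 0 = t :=
  (GraphRay.exists_toBoundary T.isTree T.infty t).choose_spec.2

theorem eq_ray {p : GraphRay T.graph} (hp : p.toBoundary = T.infty) {t : V}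
    (h0 : p.node 0 = t) : p = T.ray t :=
  GraphRay.eq_of_toBoundary T.isTree (h0.trans (T.ray_zero t).symm)
    (hp.trans (T.ray_toBoundary t).symm)

theorem ray_coincide (s t : V) : ∃ m n, (T.ray s).Coincide (T.ray t) m n :=
  Quotient.exact ((T.ray_toBoundary s).trans (T.ray_toBoundary t).symm)

theorem nonempty_nodes (T : OrientedTree V q) : Nonempty V := by
  obtain ⟨p, -⟩ := Quotient.exists_rep T.infty
  exact ⟨p.node 0⟩

/-- The level of a node: the signed number of steps by which it is further away from the
distinguished boundary point than a fixed base node. -/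
noncomputable def level (t : V) : ℤ :=
  ((T.ray_coincide t T.nonempty_nodes.some).choose : ℤ) -
    (T.ray_coincide t T.nonempty_nodes.some).choose_spec.choose

/-- Coincidences compose with additive index differences, and such a difference depends only on the
two rays; hence the choices made in `level` do not matter. -/
theorem level_sub_level {s t : V} {m n : ℕ} (h : (T.ray s).Coincide (T.ray t) m n) :
    T.level s - T.level t = m - n := by
  obtain ⟨a, b, hs, hab⟩ : ∃ a b, (T.ray s).Coincide (T.ray T.nonempty_nodes.some) a b ∧
      T.level s = a - b := ⟨_, _, (T.ray_coincide s _).choose_spec.choose_spec, rfl⟩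
  obtain ⟨c, d, ht, hcd⟩ : ∃ a b, (T.ray t).Coincide (T.ray T.nonempty_nodes.some) a b ∧
      T.level t = a - b := ⟨_, _, (T.ray_coincide t _).choose_spec.choose_spec, rfl⟩
  have h1 : (T.ray s).Coincide (T.ray T.nonempty_nodes.some) (m + c) (n + d) := fun k => by
    rw [add_assoc, h (c + k), show n + (c + k) = c + (n + k) by ring, ht (n + k),
      show d + (n + k) = n + d + k by ring]
  have h2 := hs.sub_eq T.isTree h1
  push_cast at h2
  omega

theorem isMeet_iff {s t x : V} : T.infty.IsMeet s t x ↔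
    ∃ m n, (T.ray s).MinCoincide (T.ray t) m n ∧ (T.ray s).node m = x := by
  constructor
  · rintro ⟨p, r, hp, hr, h0, h0', m, n, h, hx⟩
    obtain rfl := T.eq_ray hp h0
    obtain rfl := T.eq_ray hr h0'
    exact ⟨m, n, h, hx⟩
  · rintro ⟨m, n, h, hx⟩
    exact ⟨_, _, T.ray_toBoundary s, T.ray_toBoundary t, T.ray_zero s, T.ray_zero t, m, n, h, hx⟩

theorem exists_meet (s t : V) : ∃ x, T.infty.IsMeet s t x ∧
    T.level s - T.level t = T.graph.dist s x - T.graph.dist t x := by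
  obtain ⟨a, b, hab⟩ := T.ray_coincide s t
  obtain ⟨m, n, h⟩ := hab.exists_min T.isTree
  refine ⟨_, T.isMeet_iff.2 ⟨m, n, h, rfl⟩, ?_⟩
  have h1 := GraphRay.dist_node T.isTree (T.ray s) m
  have h2 := GraphRay.dist_node T.isTree (T.ray t) n
  rw [T.ray_zero] at h1 h2
  have h3 : (T.ray s).node m = (T.ray t).node n := by simpa using h.1 0
  rw [h1, h3, h2, T.level_sub_level h.1]

theorem IsMeet.unique {s t x y : V} (hx : T.infty.IsMeet s t x) (hy : T.infty.IsMeet s t y) :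
    x = y := by
  obtain ⟨m, n, h, rfl⟩ := T.isMeet_iff.1 hx
  obtain ⟨m', n', h', rfl⟩ := T.isMeet_iff.1 hy
  rw [le_antisymm (h.2 _ _ h'.1).1 (h'.2 _ _ h.1).1]

theorem prec_iff {s t : V} : T.infty.Prec s t ↔ T.level s ≤ T.level t := by
  obtain ⟨x, hx, h⟩ := T.exists_meet s t
  constructor
  · rintro ⟨y, hy, hd⟩
    obtain rfl := IsMeet.unique T hx hy
    omega
  · exact fun hl => ⟨x, hx, by omega⟩

theorem asymp_iff {s t : V} : T.infty.Asymp s t ↔ T.level s = T.level t := by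
  obtain ⟨x, hx, h⟩ := T.exists_meet s t
  constructor
  · rintro ⟨y, hy, hd⟩
    obtain rfl := IsMeet.unique T hx hy
    omega
  · exact fun hl => ⟨x, hx, by omega⟩

/-- The neighbour of `t` that is closer to the distinguished boundary point. -/
noncomputable def parent (t : V) : V := (T.ray t).node 1

theorem adj_parent (t : V) : T.graph.Adj t (T.parent t) := by
  simpa [T.ray_zero, parent] using (T.ray t).adj 0

theorem ray_parent (t : V) : T.ray (T.parent t) = (T.ray t).tail := by
  refine (T.eq_ray (p := (T.ray t).tail) ?_ rfl).symm
  exact (Quotient.sound ⟨0, 1, fun k => by simp [GraphRay.tail, add_comm]⟩ :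
    (T.ray t).tail.toBoundary = (T.ray t).toBoundary).trans (T.ray_toBoundary t)

theorem level_parent (t : V) : T.level (T.parent t) = T.level t - 1 := by
  have h : (T.ray t).Coincide (T.ray (T.parent t)) 1 0 := fun k => by
    rw [T.ray_parent, add_comm, zero_add]
    rfl
  have := T.level_sub_level h
  push_cast at this
  omega

/-- A neighbour other than the parent can be put in front of the ray of `t` without backtracking,
and uniqueness identifies the result with the ray of `s`. -/
theorem level_of_adj {s t : V} (h : T.graph.Adj s t) (hs : s ≠ T.parent t) :
    T.parent s = t ∧ T.level s = T.level t + 1 := by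
  have h' : T.graph.Adj s ((T.ray t).node 0) := by rwa [T.ray_zero]
  have hb : ((T.ray t).cons s h' hs).toBoundary = T.infty :=
    (Quotient.sound ⟨1, 0, fun k => by rw [add_comm 1 k, zero_add]; rfl⟩ :
      _ = (T.ray t).toBoundary).trans (T.ray_toBoundary t)
  have hc : (T.ray t).cons s h' hs = T.ray s := T.eq_ray hb rfl
  have hp : T.parent s = t := by
    rw [parent, ← hc]
    exact T.ray_zero t
  refine ⟨hp, ?_⟩
  have := T.level_parent s
  rw [hp] at this
  omega

theorem mem_range_shift {s t : V} : s ∈ Set.range (fun j => T.shift j t) ↔ T.parent s = t := by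
  rw [T.range_shift, Set.mem_ofPred_eq, T.prec_iff, SimpleGraph.dist_eq_one_iff_adj]
  constructor
  · rintro ⟨hl, ha⟩
    refine (T.level_of_adj ha.symm fun h => ?_).1
    rw [h, T.level_parent] at hl
    omega
  · rintro rfl
    refine ⟨?_, (T.adj_parent s).symm⟩
    rw [T.level_parent]
    omega

theorem parent_shift (j : Fin q) (t : V) : T.parent (T.shift j t) = t :=
  T.mem_range_shift.1 ⟨j, rfl⟩

theorem level_shift (j : Fin q) (t : V) : T.level (T.shift j t) = T.level t + 1 := by
  have := T.level_parent (T.shift j t)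
  rw [T.parent_shift] at this
  omega

theorem exists_shift_parent (t : V) : ∃ j, T.shift j (T.parent t) = t :=
  T.mem_range_shift.2 rfl

/-- A count: each of the `q + 1` neighbours is the parent or a shift of `t`, so the `q` shifts must
be distinct. -/
theorem shift_index_injective (t : V) : Function.Injective fun j => T.shift j t := by
  classical
  have hsub : T.graph.neighborSet t ⊆ insert (T.parent t) (Set.range fun j => T.shift j t) := by
    intro s hs
    by_cases h : s = T.parent t
    · exact Or.inl h
    · exact Or.inr (T.mem_range_shift.2 (T.level_of_adj (SimpleGraph.Adj.symm hs) h).1)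
  have h1 := (Set.encard_le_encard hsub).trans (Set.encard_insert_le _ _)
  rw [T.degree t] at h1
  have h2 : Set.range (fun j => T.shift j t) =
      ((Finset.univ.image fun j => T.shift j t : Finset V) : Set V) := by simp
  rw [h2, Set.encard_coe_eq_coe_finsetCard] at h1
  have h3 : q ≤ (Finset.univ.image fun j => T.shift j t).card := by
    have : ((q + 1 : ℕ) : ℕ∞) ≤ (((Finset.univ.image fun j => T.shift j t).card + 1 : ℕ) : ℕ∞) := by
      simpa using h1
    have := Nat.cast_le.1 this
    omega
  have h4 : Set.InjOn (fun j => T.shift j t) (Finset.univ : Finset (Fin q)) :=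
    Finset.card_image_iff.1 (le_antisymm Finset.card_image_le (by simpa using h3))
  exact fun i j h => h4 (by simp) (by simp) h

end OrientedTree

/-! ### Coordinate projections and operators of a given degree -/

namespace TreeL2

variable {V : Type*}

theorem inner_basisVec_left (t : V) (f : TreeL2 V) : inner ℂ (basisVec t) f = f t := by
  classical
  simp [basisVec, lp.inner_single_left]

theorem basisVec_self (t : V) : basisVec t t = 1 := by
  classical
  exact lp.single_apply_self 2 t 1

theorem basisVec_of_ne {s t : V} (h : s ≠ t) : basisVec t s = 0 := by
  classical
  exact lp.single_apply_ne 2 t 1 h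

theorem norm_basisVec (t : V) : ‖basisVec t‖ = 1 := by
  classical
  simp [basisVec, lp.norm_single]

theorem hasSum_basisVec (f : TreeL2 V) : HasSum (fun t => f t • basisVec t) f := by
  classical
  have h := lp.hasSum_single (p := 2) (by simp) f
  refine h.congr_fun fun t => ?_
  rw [basisVec, ← lp.single_smul]
  simp

theorem op_ext {X Y : TreeOp V} (h : ∀ t, X (basisVec t) = Y (basisVec t)) : X = Y := by
  refine ContinuousLinearMap.ext fun f => ?_
  have h1 := (hasSum_basisVec f).mapL X
  have h2 := (hasSum_basisVec f).mapL Y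
  simp only [map_smul, h] at h1 h2
  exact h1.unique h2

theorem mem_of_basisVec_mem {K : Submodule ℂ (TreeL2 V)} (hK : ∀ t, basisVec t ∈ K) :
    Dense (K : Set (TreeL2 V)) := fun f =>
  mem_closure_of_tendsto (hasSum_basisVec f)
    (Filter.Eventually.of_forall fun _ => K.sum_mem fun t _ => K.smul_mem _ (hK t))

theorem inner_star_left (X : TreeOp V) (f g : TreeL2 V) :
    inner ℂ (star X f) g = inner ℂ f (X g) := by
  rw [ContinuousLinearMap.star_eq_adjoint, ContinuousLinearMap.adjoint_inner_left]

theorem inner_star_right (X : TreeOp V) (f g : TreeL2 V) :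
    inner ℂ f (star X g) = inner ℂ (X f) g := by
  rw [ContinuousLinearMap.star_eq_adjoint, ContinuousLinearMap.adjoint_inner_right]

theorem norm_star_op (X : TreeOp V) : ‖star X‖ = ‖X‖ := by
  rw [ContinuousLinearMap.star_eq_adjoint, LinearIsometryEquiv.norm_map]

open Classical in
theorem proj_apply' (A : Set V) (f : TreeL2 V) (t : V) :
    proj A f t = if t ∈ A then f t else 0 := by
  rw [proj_apply, Set.indicator_apply]

theorem proj_mul_proj (A B : Set V) : proj A * proj B = proj (A ∩ B) := by
  classical
  refine ContinuousLinearMap.ext fun f => lp.ext (funext fun t => ?_)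
  by_cases hA : t ∈ A <;> by_cases hB : t ∈ B <;>
    simp [mul_apply_eq_comp, proj_apply', hA, hB]

theorem proj_empty : proj (∅ : Set V) = 0 :=
  ContinuousLinearMap.ext fun f => lp.ext (funext fun t => by simp [proj_apply])

theorem star_proj (A : Set V) : star (proj A) = proj A := by
  classical
  refine ContinuousLinearMap.ext fun f => ext_inner_right ℂ fun g => ?_
  rw [inner_star_left, lp.inner_eq_tsum, lp.inner_eq_tsum]
  refine tsum_congr fun t => ?_
  by_cases h : t ∈ A <;> simp [proj_apply', h]

theorem norm_proj_le (A : Set V) : ‖proj A‖ ≤ 1 :=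
  LinearMap.mkContinuous_norm_le _ zero_le_one _

theorem norm_compOp_le (a : V → V) (ha : Function.Injective a) : ‖compOp a ha‖ ≤ 1 :=
  LinearMap.mkContinuous_norm_le _ zero_le_one _

open Classical in
theorem proj_basisVec (A : Set V) (t : V) :
    proj A (basisVec t) = if t ∈ A then basisVec t else 0 := by
  refine lp.ext (funext fun s => ?_)
  rw [proj_apply']
  by_cases hs : s = t
  · subst hs
    by_cases h : s ∈ A <;> simp [h]
  · by_cases h : t ∈ A <;> simp [h, basisVec_of_ne hs]

/-- The passage to the block diagonal part, as a continuous linear map. -/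
noncomputable def blockDiagL (r : Setoid V) : TreeOp V →L[ℂ] TreeOp V :=
  LinearMap.mkContinuous
    { toFun := blockDiag r
      map_add' := fun A B => ContinuousLinearMap.ext fun f => lp.ext <| funext fun s => rfl
      map_smul' := fun c A => ContinuousLinearMap.ext fun f => lp.ext <| funext fun s => rfl } 1
    fun A => by
      rw [one_mul]
      exact ContinuousLinearMap.opNorm_le_bound _ (norm_nonneg A) fun f =>
        norm_le_of_sum_le (by positivity) (sum_blockDiag_le r A f)

theorem blockDiagL_apply (r : Setoid V) (A : TreeOp V) : blockDiagL r A = blockDiag r A := rfl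

end TreeL2

/-! ### Level projections and homogeneous operators -/

namespace OrientedTree

open TreeL2

variable {V : Type*} {q : ℕ} (T : OrientedTree V q)

/-- The projection onto the functions supported on the level `k`. -/
noncomputable def levelProj (k : ℤ) : TreeOp V := proj {t | T.level t = k}

/-- The projection onto the functions supported on the levels from `n` on. -/
noncomputable def levelProjGE (n : ℤ) : TreeOp V := proj {t | n ≤ T.level t}

theorem levelProj_apply (k : ℤ) (f : TreeL2 V) (t : V) :
    T.levelProj k f t = if T.level t = k then f t else 0 := by
  classical
  simp [levelProj, proj_apply']

theorem levelProjGE_apply (n : ℤ) (f : TreeL2 V) (t : V) :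
    T.levelProjGE n f t = if n ≤ T.level t then f t else 0 := by
  classical
  simp [levelProjGE, proj_apply']

theorem levelProj_basisVec (k : ℤ) (t : V) :
    T.levelProj k (basisVec t) = if T.level t = k then basisVec t else 0 := by
  classical
  simp [levelProj, proj_basisVec]

theorem levelProjGE_basisVec (n : ℤ) (t : V) :
    T.levelProjGE n (basisVec t) = if n ≤ T.level t then basisVec t else 0 := by
  classical
  simp [levelProjGE, proj_basisVec]

theorem star_levelProj (k : ℤ) : star (T.levelProj k) = T.levelProj k := star_proj _

theorem star_levelProjGE (n : ℤ) : star (T.levelProjGE n) = T.levelProjGE n := star_proj _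

theorem levelProj_mul_self (k : ℤ) : T.levelProj k * T.levelProj k = T.levelProj k := by
  rw [levelProj, proj_mul_proj, Set.inter_self]

theorem levelProj_mul_of_ne {k l : ℤ} (h : k ≠ l) : T.levelProj k * T.levelProj l = 0 := by
  rw [levelProj, levelProj, proj_mul_proj, ← proj_empty]
  congr 1
  ext t
  simp only [Set.mem_inter_iff, Set.mem_ofPred_eq, Set.mem_empty_iff_false, iff_false]
  omega

theorem levelProjGE_mul_levelProjGE {m n : ℤ} (h : m ≤ n) :
    T.levelProjGE m * T.levelProjGE n = T.levelProjGE n := by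
  rw [levelProjGE, levelProjGE, proj_mul_proj]
  congr 1
  ext t
  simp only [Set.mem_inter_iff, Set.mem_ofPred_eq]
  omega

theorem levelProjGE_mul_levelProj {n k : ℤ} (h : n ≤ k) :
    T.levelProjGE n * T.levelProj k = T.levelProj k := by
  rw [levelProjGE, levelProj, proj_mul_proj]
  congr 1
  ext t
  simp only [Set.mem_inter_iff, Set.mem_ofPred_eq]
  omega

theorem levelProj_mul_levelProjGE_of_lt {n k : ℤ} (h : k < n) :
    T.levelProj k * T.levelProjGE n = 0 := by
  rw [levelProjGE, levelProj, proj_mul_proj, ← proj_empty]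
  congr 1
  ext t
  simp only [Set.mem_inter_iff, Set.mem_ofPred_eq, Set.mem_empty_iff_false, iff_false]
  omega

theorem levelProj_ext {X Y : TreeOp V} (h : ∀ k, T.levelProj k * X = T.levelProj k * Y) :
    X = Y := by
  refine ContinuousLinearMap.ext fun f => lp.ext (funext fun t => ?_)
  have := congrArg (fun Z : TreeOp V => Z f t) (h (T.level t))
  simpa [mul_apply_eq_comp, T.levelProj_apply] using this

theorem levelProj_ext_right {X Y : TreeOp V} (h : ∀ k, X * T.levelProj k = Y * T.levelProj k) :
    X = Y := by
  refine op_ext fun t => ?_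
  have := congrArg (fun Z : TreeOp V => Z (basisVec t)) (h (T.level t))
  simpa [mul_apply_eq_comp, T.levelProj_basisVec] using this

/-- An operator has degree `d` if it maps functions supported on the level `k` to functions
supported on the level `k + d`. -/
def HasDegree (X : TreeOp V) (d : ℤ) : Prop :=
  ∀ k, X * T.levelProj k = T.levelProj (k + d) * X

variable {T}

namespace HasDegree

variable {X Y : TreeOp V} {d e : ℤ}

theorem levelProj_mul (hX : T.HasDegree X d) (k : ℤ) :
    T.levelProj k * X = X * T.levelProj (k - d) := by
  rw [hX, sub_add_cancel]

theorem mul (hX : T.HasDegree X d) (hY : T.HasDegree Y e) : T.HasDegree (X * Y) (d + e) :=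
  fun k => by
    rw [mul_assoc, hY, ← mul_assoc, hX, mul_assoc]
    congr 2
    ring

theorem one : T.HasDegree 1 0 := fun k => by simp

theorem pow (hX : T.HasDegree X d) (n : ℕ) : T.HasDegree (X ^ n) (n * d) := by
  induction n with
  | zero => simpa using HasDegree.one
  | succ n ih =>
    rw [pow_succ]
    convert ih.mul hX using 1
    push_cast
    ring

theorem star (hX : T.HasDegree X d) : T.HasDegree (star X) (-d) := fun k => by
  have := congrArg Star.star (hX.levelProj_mul k)
  simpa [T.star_levelProj, sub_eq_add_neg] using this

theorem sub (hX : T.HasDegree X d) (hY : T.HasDegree Y d) : T.HasDegree (X - Y) d :=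
  fun k => by rw [sub_mul, mul_sub, hX, hY]

theorem sum {ι : Type*} {F : Finset ι} {X : ι → TreeOp V} (hX : ∀ i ∈ F, T.HasDegree (X i) d) :
    T.HasDegree (∑ i ∈ F, X i) d := fun k => by
  rw [Finset.sum_mul, Finset.mul_sum]
  exact Finset.sum_congr rfl fun i hi => hX i hi k

theorem hasSum {ι : Type*} {f : ι → TreeOp V} (h : HasSum f X) (hf : ∀ i, T.HasDegree (f i) d) :
    T.HasDegree X d := fun k => by
  have h1 := h.mul_right (T.levelProj k)
  have h2 := h.mul_left (T.levelProj (k + d))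
  simp only [fun i => hf i k] at h1
  exact h1.unique h2

end HasDegree

variable (T)

theorem hasDegree_proj (A : Set V) : T.HasDegree (proj A) 0 := fun k => by
  rw [add_zero, levelProj, proj_mul_proj, proj_mul_proj, Set.inter_comm]

theorem hasDegree_shiftOp (j : Fin q) : T.HasDegree (T.shiftOp j) (-1) := fun k => by
  refine ContinuousLinearMap.ext fun f => lp.ext (funext fun t => ?_)
  simp only [mul_apply_eq_comp, shiftOp, compOp_apply, T.levelProj_apply, T.level_shift]
  congr 1
  simp only [eq_iff_iff]
  omega

theorem hasDegree_wordOp (w : List (Fin q)) : T.HasDegree (T.wordOp w) (-w.length) := by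
  induction w with
  | nil => simpa [wordOp] using HasDegree.one
  | cons j w ih =>
    have h : T.wordOp (j :: w) = T.shiftOp j * T.wordOp w := by simp [wordOp]
    rw [h]
    convert (T.hasDegree_shiftOp j).mul ih using 1
    simp

/-! ### Causal operators and constants -/

theorem mem_causal {S : TreeOp V} : S ∈ T.causal ↔ ∀ (s : V) (f : TreeL2 V),
    (∀ t, T.level t ≤ T.level s → f t = 0) → ∀ t, T.level t ≤ T.level s → S f t = 0 := by
  simp only [causal, Set.mem_ofPred_eq, T.prec_iff]

/-- Vanishing at all `t ⪯ s` means being supported on levels `≥ level s + 1`, so causality is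
invariance of a family of subspaces indexed by `ℤ`. -/
theorem causal_iff {S : TreeOp V} :
    S ∈ T.causal ↔ ∀ n, T.levelProjGE n * S * T.levelProjGE n = S * T.levelProjGE n := by
  rw [T.mem_causal]
  constructor
  · intro h n
    refine op_ext fun t => lp.ext (funext fun s => ?_)
    simp only [mul_apply_eq_comp, T.levelProjGE_apply, T.levelProjGE_basisVec]
    split_ifs with h1 h2 h2
    · rfl
    · rfl
    · refine (h s (basisVec t) (fun u hu => basisVec_of_ne ?_) s le_rfl).symm
      rintro rfl
      omega
    · simp
  · intro h s f hf t ht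
    have hf' : T.levelProjGE (T.level s + 1) f = f := by
      refine lp.ext (funext fun u => ?_)
      rw [T.levelProjGE_apply]
      split_ifs with hu
      · rfl
      · exact (hf u (by omega)).symm
    have h1 := congrArg (fun Z : TreeOp V => Z f t) (h (T.level s + 1))
    simp only [mul_apply_eq_comp, hf', T.levelProjGE_apply] at h1
    rw [← h1, if_neg (by omega)]

variable {T}

theorem causal_mul {X Y : TreeOp V} (hX : X ∈ T.causal) (hY : Y ∈ T.causal) :
    X * Y ∈ T.causal := fun s f hf => hX s _ (hY s f hf)

theorem causal_sub {X Y : TreeOp V} (hX : X ∈ T.causal) (hY : Y ∈ T.causal) :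
    X - Y ∈ T.causal := fun s f hf t ht => by
  simp [hX s f hf t ht, hY s f hf t ht]

theorem one_mem_causal : (1 : TreeOp V) ∈ T.causal := fun _ _ hf => hf

theorem causal_hasSum {ι : Type*} {f : ι → TreeOp V} {X : TreeOp V} (h : HasSum f X)
    (hf : ∀ i, f i ∈ T.causal) : X ∈ T.causal := by
  rw [T.causal_iff]
  intro n
  have h1 := h.mul_right (T.levelProjGE n)
  have h2 := (h.mul_left (T.levelProjGE n)).mul_right (T.levelProjGE n)
  simp only [fun i => T.causal_iff.1 (hf i) n] at h2
  exact h2.unique h1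

theorem HasDegree.mem_causal {X : TreeOp V} {d : ℤ} (hX : T.HasDegree X d) (hd : 0 ≤ d) :
    X ∈ T.causal := by
  rw [T.mem_causal]
  intro s f hf t ht
  have h1 := congrArg (fun Z : TreeOp V => Z f t) (hX.levelProj_mul (T.level t))
  have h2 : T.levelProj (T.level t - d) f = 0 := by
    refine lp.ext (funext fun u => ?_)
    rw [T.levelProj_apply]
    split_ifs with hu
    · exact hf u (by omega)
    · rfl
  simpa [mul_apply_eq_comp, T.levelProj_apply, h2] using h1

theorem levelProj_mul_causal {X : TreeOp V} (hX : X ∈ T.causal) {k l : ℤ} (h : k < l) :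
    T.levelProj k * X * T.levelProj l = 0 := by
  calc T.levelProj k * X * T.levelProj l
      = T.levelProj k * (X * T.levelProjGE l) * T.levelProj l := by
        nth_rewrite 1 [← T.levelProjGE_mul_levelProj (le_refl l)]
        simp only [mul_assoc]
    _ = T.levelProj k * T.levelProjGE l * X * T.levelProjGE l * T.levelProj l := by
        rw [← T.causal_iff.1 hX l]
        simp only [mul_assoc]
    _ = 0 := by simp [T.levelProj_mul_levelProjGE_of_lt h]

/-- Causality of `X` kills the blocks mapping a level to a lower one, causality of `star X` those
mapping to a higher one; only the diagonal blocks survive. -/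
theorem mem_constants {X : TreeOp V} : X ∈ T.constants ↔ T.HasDegree X 0 := by
  constructor
  · rintro ⟨h1, h2⟩ k
    rw [add_zero]
    refine T.levelProj_ext fun l => T.levelProj_ext_right fun m => ?_
    have key : l ≠ m → T.levelProj l * X * T.levelProj m = 0 := by
      intro hlm
      rcases lt_or_gt_of_ne hlm with h | h
      · exact levelProj_mul_causal h1 h
      · have := congrArg star (levelProj_mul_causal h2 h)
        simpa [T.star_levelProj, mul_assoc] using this
    by_cases hlm : l = m
    · subst hlm
      by_cases hk : k = l
      · subst hk
        simp only [mul_assoc, T.levelProj_mul_self]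
        simp only [← mul_assoc, T.levelProj_mul_self]
      · simp only [mul_assoc, T.levelProj_mul_of_ne hk]
        simp [← mul_assoc, T.levelProj_mul_of_ne (Ne.symm hk)]
    · have h0 := key hlm
      by_cases hk : k = m
      · subst hk
        simp only [mul_assoc, T.levelProj_mul_self] at h0 ⊢
        rw [h0, ← mul_assoc, T.levelProj_mul_of_ne hlm, zero_mul]
      · simp only [mul_assoc, T.levelProj_mul_of_ne hk, mul_zero]
        by_cases hk' : l = k
        · subst hk'
          rw [← mul_assoc, T.levelProj_mul_self, ← mul_assoc, h0]
        · rw [← mul_assoc, T.levelProj_mul_of_ne hk', zero_mul]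
  · intro h
    exact ⟨h.mem_causal le_rfl, by simpa using h.star.mem_causal (d := -0) (by simp)⟩

/-! ### The block diagonal part -/

variable (T)

/-- The block diagonal part of an operator with respect to the levels. -/
noncomputable def diagPart : TreeOp V →L[ℂ] TreeOp V := blockDiagL T.horocycle

theorem levelProj_mul_diagPart (X : TreeOp V) (k : ℤ) :
    T.levelProj k * T.diagPart X = T.levelProj k * X * T.levelProj k := by
  refine ContinuousLinearMap.ext fun f => lp.ext (funext fun s => ?_)
  have hset : T.level s = k → proj {t | T.horocycle t s} = T.levelProj k := by
    rintro rfl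
    rw [levelProj]
    congr 1
    ext t
    exact T.asymp_iff
  simp only [mul_apply_eq_comp, T.levelProj_apply, diagPart, blockDiagL_apply, blockDiag_apply]
  split_ifs with h
  · rw [hset h]
  · rfl

variable {T}

theorem eq_diagPart {X Y : TreeOp V}
    (h : ∀ k, T.levelProj k * Y = T.levelProj k * X * T.levelProj k) : Y = T.diagPart X :=
  T.levelProj_ext fun k => by rw [h, T.levelProj_mul_diagPart]

theorem hasDegree_diagPart (X : TreeOp V) : T.HasDegree (T.diagPart X) 0 := fun k => by
  rw [add_zero]
  refine T.levelProj_ext fun l => ?_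
  rw [← mul_assoc, T.levelProj_mul_diagPart, ← mul_assoc]
  by_cases h : l = k
  · subst h
    rw [mul_assoc, T.levelProj_mul_self, T.levelProj_mul_diagPart]
  · rw [mul_assoc, T.levelProj_mul_of_ne h, mul_zero, zero_mul]

theorem diagPart_mul_levelProj (X : TreeOp V) (k : ℤ) :
    T.diagPart X * T.levelProj k = T.levelProj k * X * T.levelProj k := by
  rw [hasDegree_diagPart X k, add_zero, T.levelProj_mul_diagPart]

/-- Opposite degrees cancel: `B` moves level `k` to `k + d` and `A` moves it back, so the diagonal
block at `k` sees only the block of `X` at `k + d`. -/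
theorem diagPart_conj {A B : TreeOp V} {d : ℤ} (hA : T.HasDegree A (-d)) (hB : T.HasDegree B d)
    (X : TreeOp V) : T.diagPart (A * X * B) = A * T.diagPart X * B := by
  refine (eq_diagPart fun k => ?_).symm
  have h1 := hA.levelProj_mul k
  have h2 := hB k
  rw [sub_neg_eq_add] at h1
  calc T.levelProj k * (A * T.diagPart X * B)
      = (T.levelProj k * A) * T.diagPart X * B := by simp only [mul_assoc]
    _ = A * (T.levelProj (k + d) * T.diagPart X) * B := by rw [h1]; simp only [mul_assoc]
    _ = A * T.levelProj (k + d) * X * (T.levelProj (k + d) * B) := by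
        rw [T.levelProj_mul_diagPart]; simp only [mul_assoc]
    _ = T.levelProj k * (A * X * B) * T.levelProj k := by
        rw [← h1, ← h2]; simp only [mul_assoc]

theorem diagPart_mul_left {A : TreeOp V} (hA : T.HasDegree A 0) (X : TreeOp V) :
    T.diagPart (A * X) = A * T.diagPart X := by
  simpa using diagPart_conj (d := 0) (by simpa using hA) HasDegree.one X

theorem diagPart_mul_right {B : TreeOp V} (hB : T.HasDegree B 0) (X : TreeOp V) :
    T.diagPart (X * B) = T.diagPart X * B := by
  have := diagPart_conj (A := (1 : TreeOp V)) (d := 0) (by simpa using HasDegree.one) hB X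
  rwa [one_mul, one_mul] at this

theorem HasDegree.diagPart_eq_self {X : TreeOp V} (hX : T.HasDegree X 0) : T.diagPart X = X := by
  refine (eq_diagPart fun k => ?_).symm
  have := hX k
  rw [add_zero] at this
  rw [← this, mul_assoc, T.levelProj_mul_self]

theorem HasDegree.diagPart_eq_zero {X : TreeOp V} {d : ℤ} (hX : T.HasDegree X d) (hd : d ≠ 0) :
    T.diagPart X = 0 := by
  refine (eq_diagPart fun k => ?_).symm
  rw [mul_assoc, hX k, ← mul_assoc, T.levelProj_mul_of_ne (by omega), zero_mul, mul_zero]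

end OrientedTree

/-! ### Point evaluation and the kernel in terms of the resolvent -/

namespace OrientedTree

open TreeL2

variable {V : Type*} {q : ℕ} (T : OrientedTree V q)

theorem shiftOp_basisVec (j : Fin q) (s : V) [Decidable (T.shift j (T.parent s) = s)] :
    T.shiftOp j (basisVec s) =
      if T.shift j (T.parent s) = s then basisVec (T.parent s) else 0 := by
  refine lp.ext (funext fun t => ?_)
  rw [shiftOp, compOp_apply]
  by_cases ht : t = T.parent s
  · subst ht
    split_ifs with h
    · rw [h, basisVec_self, basisVec_self]
    · simpa using basisVec_of_ne h
  · have h1 : T.shift j t ≠ s := by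
      rintro rfl
      exact ht (T.parent_shift j t).symm
    rw [basisVec_of_ne h1]
    split_ifs
    · exact (basisVec_of_ne ht).symm
    · rfl

theorem star_shiftOp_basisVec (j : Fin q) (t : V) :
    star (T.shiftOp j) (basisVec t) = basisVec (T.shift j t) :=
  ext_inner_right ℂ fun f => by
    rw [inner_star_left, inner_basisVec_left, inner_basisVec_left, shiftOp, compOp_apply]

theorem sum_star_shiftOp_mul : ∑ j, star (T.shiftOp j) * T.shiftOp j = 1 := by
  classical
  refine op_ext fun s => ?_
  obtain ⟨i, hi⟩ := T.exists_shift_parent s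
  simp only [sum_apply, mul_apply_eq_comp, T.shiftOp_basisVec]
  rw [Finset.sum_eq_single i]
  · rw [if_pos hi, T.star_shiftOp_basisVec, hi]
    rfl
  · intro j _ hj
    rw [if_neg, map_zero]
    intro h
    exact hj (T.shift_index_injective (T.parent s) (h.trans hi.symm))
  · simp

theorem sum_star_wordOp_mul (n : ℕ) :
    ∑ w : Fin n → Fin q, star (T.wordOp (List.ofFn w)) * T.wordOp (List.ofFn w) = 1 := by
  induction n with
  | zero => simp [wordOp]
  | succ n ih =>
    rw [← (Fin.consEquiv fun _ => Fin q).sum_comp, Fintype.sum_prod_type, Finset.sum_comm,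
      ← ih]
    refine Finset.sum_congr rfl fun w _ => ?_
    have h : ∀ j, T.wordOp (List.ofFn ((Fin.consEquiv fun _ => Fin q) (j, w))) =
        T.shiftOp j * T.wordOp (List.ofFn w) := fun j => by
      simp [wordOp, Fin.consEquiv]
    simp only [h, star_mul]
    calc ∑ j, star (T.wordOp (List.ofFn w)) * star (T.shiftOp j) *
          (T.shiftOp j * T.wordOp (List.ofFn w))
        = star (T.wordOp (List.ofFn w)) * (∑ j, star (T.shiftOp j) * T.shiftOp j) *
          T.wordOp (List.ofFn w) := by
          simp only [Finset.mul_sum, Finset.sum_mul, mul_assoc]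
      _ = _ := by rw [T.sum_star_shiftOp_mul, mul_one]

variable {T}

/-! ### The resolvent of a point of the ball -/

theorem hasDegree_rowShift {c : Fin q → TreeOp V} (hc : c ∈ T.ball) :
    T.HasDegree (T.rowShift c) (-1) :=
  HasDegree.sum fun j _ => by
    simpa using (mem_constants.1 (hc.1 j)).mul (T.hasDegree_shiftOp j)

theorem hasDegree_rowShift_pow {c : Fin q → TreeOp V} (hc : c ∈ T.ball) (n : ℕ) :
    T.HasDegree (T.rowShift c ^ n) (-n) := by
  simpa using (hasDegree_rowShift hc).pow n

theorem hasDegree_star_rowShift_pow {c : Fin q → TreeOp V} (hc : c ∈ T.ball) (n : ℕ) :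
    T.HasDegree (star (T.rowShift c ^ n)) n := by
  simpa using (hasDegree_rowShift_pow hc n).star

/-- The root test: a limit below `1` gives geometric domination from some index on. -/
theorem summable_norm_rowShift_pow {c : Fin q → TreeOp V} (hc : c ∈ T.ball) :
    Summable fun n => ‖T.rowShift c ^ n‖ := by
  obtain ⟨-, ρ, hρ, hlim⟩ := hc
  obtain ⟨r, hρr, hr⟩ := exists_between hρ
  have hev := hlim.eventually_lt_const hρr
  have h0 : 0 ≤ r := by
    obtain ⟨n, hn⟩ := hev.exists
    exact (Real.rpow_nonneg (norm_nonneg _) _).trans hn.le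
  refine Summable.of_norm_bounded_eventually_nat (summable_geometric_of_lt_one h0 hr) ?_
  filter_upwards [hev, Filter.eventually_gt_atTop 0] with n hn hn0
  rw [norm_norm]
  calc ‖T.rowShift c ^ n‖ = (‖T.rowShift c ^ n‖ ^ (1 / (n : ℝ))) ^ n := by
        rw [one_div, Real.rpow_inv_natCast_pow (norm_nonneg _) hn0.ne']
    _ ≤ r ^ n := by gcongr

theorem summable_rowShift_pow {c : Fin q → TreeOp V} (hc : c ∈ T.ball) :
    Summable fun n => T.rowShift c ^ n := (summable_norm_rowShift_pow hc).of_norm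

variable (T) in
/-- The resolvent `∑ₙ (c α)^n = (I - c α)^{-1}`. -/
noncomputable def resolvent (c : Fin q → TreeOp V) : TreeOp V := ∑' n : ℕ, T.rowShift c ^ n

theorem hasSum_resolvent {c : Fin q → TreeOp V} (hc : c ∈ T.ball) :
    HasSum (fun n => T.rowShift c ^ n) (T.resolvent c) := (summable_rowShift_pow hc).hasSum

theorem one_sub_mul_resolvent {c : Fin q → TreeOp V} (hc : c ∈ T.ball) :
    (1 - T.rowShift c) * T.resolvent c = 1 := (summable_rowShift_pow hc).one_sub_mul_tsum_pow

theorem resolvent_mul_one_sub {c : Fin q → TreeOp V} (hc : c ∈ T.ball) :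
    T.resolvent c * (1 - T.rowShift c) = 1 := (summable_rowShift_pow hc).tsum_pow_mul_one_sub

theorem resolvent_eq_sum_add {c : Fin q → TreeOp V} (hc : c ∈ T.ball) (m : ℕ) :
    T.resolvent c = ∑ n ∈ Finset.range m, T.rowShift c ^ n + T.rowShift c ^ m * T.resolvent c := by
  have h := (summable_rowShift_pow hc).sum_add_tsum_nat_add m
  have h2 := ((hasSum_resolvent hc).mul_left (T.rowShift c ^ m)).tsum_eq
  simp only [← pow_add, add_comm m] at h2
  rw [← h2, h, resolvent]

theorem hasSum_star_resolvent {c : Fin q → TreeOp V} (hc : c ∈ T.ball) :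
    HasSum (fun n => star (T.rowShift c ^ n)) (star (T.resolvent c)) :=
  (hasSum_resolvent hc).star

theorem star_resolvent_mem_causal {c : Fin q → TreeOp V} (hc : c ∈ T.ball) :
    star (T.resolvent c) ∈ T.causal :=
  causal_hasSum (hasSum_star_resolvent hc) fun n =>
    (hasDegree_star_rowShift_pow hc n).mem_causal (by positivity)

theorem isUnit_one_sub_star {c : Fin q → TreeOp V} (hc : c ∈ T.ball) :
    IsUnit (1 - star (T.rowShift c)) := by
  have h1 := congrArg star (one_sub_mul_resolvent hc)
  have h2 := congrArg star (resolvent_mul_one_sub hc)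
  simp only [star_mul, star_sub, star_one] at h1 h2
  exact ⟨⟨_, _, h2, h1⟩, rfl⟩

theorem cauchyKernel_eq {c : Fin q → TreeOp V} (hc : c ∈ T.ball) :
    T.cauchyKernel c = star (T.resolvent c) := by
  have h1 := congrArg star (one_sub_mul_resolvent hc)
  have h2 := congrArg star (resolvent_mul_one_sub hc)
  simp only [star_mul, star_sub, star_one] at h1 h2
  exact Ring.inverse_unit ⟨_, _, h2, h1⟩

/-- Insert `∑ w^* w = 1` over words of length `n`; the left factor `(c α)^n w^*` has degree `0`, so
it passes through `diagPart` and leaves `S_[w]`. -/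
theorem rowShift_pow_mul_homogPart {c : Fin q → TreeOp V} (hc : c ∈ T.ball) (S : TreeOp V)
    (n : ℕ) : T.rowShift c ^ n * T.homogPart S n = T.diagPart (T.rowShift c ^ n * S) := by
  have h : T.rowShift c ^ n * S = ∑ w : Fin n → Fin q,
      T.rowShift c ^ n * star (T.wordOp (List.ofFn w)) * (T.wordOp (List.ofFn w) * S) := by
    calc T.rowShift c ^ n * S = T.rowShift c ^ n * (∑ w : Fin n → Fin q,
          star (T.wordOp (List.ofFn w)) * T.wordOp (List.ofFn w)) * S := by
          rw [T.sum_star_wordOp_mul, mul_one]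
      _ = _ := by simp only [Finset.mul_sum, Finset.sum_mul, mul_assoc]
  rw [h, map_sum, homogPart, Finset.mul_sum]
  refine Finset.sum_congr rfl fun w _ => ?_
  rw [diagPart_mul_left, mul_assoc]
  · rfl
  · simpa using (hasDegree_rowShift_pow hc n).mul (T.hasDegree_wordOp (List.ofFn w)).star

theorem pointEval_eq {c : Fin q → TreeOp V} (hc : c ∈ T.ball) (S : TreeOp V) :
    T.pointEval S c = T.diagPart (T.resolvent c * S) := by
  simp only [pointEval, rowShift_pow_mul_homogPart hc]
  exact (((hasSum_resolvent hc).mul_right S).mapL T.diagPart).tsum_eq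

theorem hasSum_conj_rowShift_pow {c d : Fin q → TreeOp V} (hc : c ∈ T.ball) (hd : d ∈ T.ball)
    {X : TreeOp V} (hX : T.HasDegree X 0) :
    HasSum (fun n => T.rowShift c ^ n * X * star (T.rowShift d ^ n))
      (T.diagPart (T.resolvent c * X * star (T.resolvent d))) := by
  have h1 := ((hasSum_star_resolvent hd).mul_left (T.resolvent c * X)).mapL T.diagPart
  convert h1 using 2 with n
  have h2 := ((hasSum_resolvent hc).mul_right (X * star (T.rowShift d ^ n))).mapL T.diagPart
  have hdeg : ∀ m : ℕ, T.HasDegree (T.rowShift c ^ m * (X * star (T.rowShift d ^ n))) (-m + n) :=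
    fun m => by
      simpa using (hasDegree_rowShift_pow hc m).mul (hX.mul (hasDegree_star_rowShift_pow hd n))
  -- The term with index `m` has degree `n - m`, so only `m = n` contributes to the diagonal.
  have h3 := hasSum_single (f := fun m =>
    T.diagPart (T.rowShift c ^ m * (X * star (T.rowShift d ^ n)))) n fun m hm =>
      (hdeg m).diagPart_eq_zero (by omega)
  have h4 : T.HasDegree (T.rowShift c ^ n * (X * star (T.rowShift d ^ n))) 0 := by
    simpa using hdeg n
  rw [mul_assoc, mul_assoc, h2.unique h3]
  exact h4.diagPart_eq_self.symm

theorem diagPart_resolvent {c : Fin q → TreeOp V} (hc : c ∈ T.ball) :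
    T.diagPart (T.resolvent c) = 1 := by
  have h2 := (hasSum_resolvent hc).mapL T.diagPart
  have h3 := hasSum_single (f := fun m : ℕ => T.diagPart (T.rowShift c ^ m)) 0 fun m hm =>
      (hasDegree_rowShift_pow hc m).diagPart_eq_zero (by omega)
  rw [h2.unique h3, pow_zero]
  exact HasDegree.one.diagPart_eq_self

/-! ### Causal operators behind a resolvent -/

/-- Split `R_c` after `m` terms. For `n < m` the term contains the block of `S` from level `k + m`
to the lower level `k + n`, which vanishes by causality; the tail `(c α)^m R_c` leaves a diagonal
block. -/
theorem levelProj_mul_resolvent_mul {c : Fin q → TreeOp V} (hc : c ∈ T.ball) {S : TreeOp V}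
    (hS : S ∈ T.causal) (k : ℤ) (m : ℕ) :
    T.levelProj k * T.resolvent c * S * T.levelProj (k + m) =
      T.rowShift c ^ m * T.diagPart (T.resolvent c * S) * T.levelProj (k + m) := by
  have hP : ∀ n : ℕ, T.levelProj k * T.rowShift c ^ n =
      T.rowShift c ^ n * T.levelProj (k + n) := fun n => by
    rw [(hasDegree_rowShift_pow hc n).levelProj_mul, sub_neg_eq_add]
  rw [mul_assoc _ (T.diagPart _), diagPart_mul_levelProj]
  conv_lhs => rw [resolvent_eq_sum_add hc m]
  rw [mul_add, add_mul, add_mul, Finset.mul_sum, Finset.sum_mul, Finset.sum_mul,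
    Finset.sum_eq_zero, zero_add, ← mul_assoc, hP]
  · simp only [mul_assoc]
  · intro n hn
    have hn' := Finset.mem_range.1 hn
    rw [hP, mul_assoc, mul_assoc, ← mul_assoc (T.levelProj _),
      levelProj_mul_causal hS (by omega), mul_zero]

/-- Apply the preceding identity to `S` and to the constant `S^∧(c)`. Both give the same result,
since `diagPart (R_c S^∧(c)) = S^∧(c)`. -/
theorem levelProj_resolvent_mul_levelProjGE {c : Fin q → TreeOp V} (hc : c ∈ T.ball)
    {S : TreeOp V} (hS : S ∈ T.causal) (k : ℤ) :
    T.levelProj k * T.resolvent c * S * T.levelProjGE k =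
      T.levelProj k * T.resolvent c * T.pointEval S c * T.levelProjGE k := by
  refine T.levelProj_ext_right fun l => ?_
  rcases lt_or_ge l k with h | h
  · have h0 : T.levelProjGE k * T.levelProj l = 0 := by
      simpa [T.star_levelProj, T.star_levelProjGE] using
        congrArg star (T.levelProj_mul_levelProjGE_of_lt h)
    rw [mul_assoc _ (T.levelProjGE k), mul_assoc _ (T.levelProjGE k), h0, mul_zero, mul_zero]
  · obtain ⟨m, rfl⟩ := Int.le.dest h
    have hdeg := hasDegree_diagPart (T := T) (T.resolvent c * S)
    rw [mul_assoc _ (T.levelProjGE k), mul_assoc _ (T.levelProjGE k),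
      T.levelProjGE_mul_levelProj h, levelProj_mul_resolvent_mul hc hS, pointEval_eq hc,
      levelProj_mul_resolvent_mul hc (hdeg.mem_causal le_rfl), diagPart_mul_right hdeg,
      diagPart_resolvent hc, one_mul]

/-- Causality of `Y` keeps the image of level `k` in levels `≥ k`, where `R_c S` may be replaced by
`R_c S^∧(c)`. -/
theorem diagPart_resolvent_mul_mul {c : Fin q → TreeOp V} (hc : c ∈ T.ball)
    {S Y : TreeOp V} (hS : S ∈ T.causal) (hY : Y ∈ T.causal) :
    T.diagPart (T.resolvent c * S * Y) = T.diagPart (T.resolvent c * T.pointEval S c * Y) := by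
  refine eq_diagPart fun k => ?_
  rw [T.levelProj_mul_diagPart]
  have hYk : Y * T.levelProj k = T.levelProjGE k * (Y * T.levelProj k) := by
    rw [← T.levelProjGE_mul_levelProj (le_refl k)]
    simp only [← mul_assoc]
    rw [T.causal_iff.1 hY]
  have key := congrArg (· * (Y * T.levelProj k)) (levelProj_resolvent_mul_levelProjGE hc hS k)
  simp only [mul_assoc] at key ⊢
  rwa [← hYk] at key

/-! ### The kernel -/

theorem hasDegree_one_sub_mul_star (a b : T.constants) :
    T.HasDegree (1 - (a : TreeOp V) * star (b : TreeOp V)) 0 := by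
  have := (mem_constants.1 a.2).mul (mem_constants.1 b.2).star
  rw [neg_zero, add_zero] at this
  exact HasDegree.one.sub this

theorem kernel_eq (s : T.ball → T.constants) (c d : T.ball) :
    T.kernel s c d = T.diagPart (T.resolvent c *
      (1 - (s c : TreeOp V) * star (s d : TreeOp V)) * star (T.resolvent d)) :=
  (hasSum_conj_rowShift_pow c.2 d.2 (hasDegree_one_sub_mul_star _ _)).tsum_eq

theorem summable_norm_kernelTerm (s : T.ball → T.constants) (c d : T.ball) :
    Summable fun n => ‖T.kernelTerm s c d n‖ := by
  have hd := summable_norm_rowShift_pow d.2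
  refine Summable.of_nonneg_of_le (fun _ => norm_nonneg _) (fun n => ?_)
    ((summable_norm_rowShift_pow c.2).mul_right
      (‖1 - (s c : TreeOp V) * star (s d : TreeOp V)‖ * ∑' n, ‖T.rowShift d ^ n‖))
  calc ‖T.kernelTerm s c d n‖
      ≤ ‖T.rowShift (c : Fin q → TreeOp V) ^ n‖ *
        ‖1 - (s c : TreeOp V) * star (s d : TreeOp V)‖ *
          ‖star (T.rowShift (d : Fin q → TreeOp V) ^ n)‖ :=
        (norm_mul_le _ _).trans (by gcongr; exact norm_mul_le _ _)
    _ ≤ _ := by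
      rw [norm_star_op, mul_assoc]
      gcongr
      exact hd.le_tsum n fun _ _ => norm_nonneg _

theorem kernel_mem_constants (s : T.ball → T.constants) (c d : T.ball) :
    T.kernel s c d ∈ T.constants := by
  rw [kernel_eq]
  exact mem_constants.2 (hasDegree_diagPart _)

theorem schurKernel_mem_causal {S : TreeOp V} (hS : S ∈ T.causal) {d : Fin q → TreeOp V}
    (hd : d ∈ T.ball) : T.schurKernel S d ∈ T.causal := by
  rw [schurKernel, cauchyKernel_eq hd]
  refine causal_mul (causal_sub one_mem_causal (causal_mul hS ?_)) (star_resolvent_mem_causal hd)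
  rw [pointEval_eq hd]
  exact (mem_constants.2 (hasDegree_diagPart _)).2

theorem kernel_eq_pointEval {s : T.ball → T.constants} {S : TreeOp V} (hS : S ∈ T.causal)
    (hs : ∀ c : T.ball, (s c : TreeOp V) = T.pointEval S c) (c d : T.ball) :
    T.kernel s c d = T.pointEval (T.schurKernel S d) c := by
  -- The two sides differ only by `s(c)` in place of `S` between `R_c` and this causal factor.
  have hY : star (s d : TreeOp V) * star (T.resolvent d) ∈ T.causal :=
    causal_mul (s d).2.2 (star_resolvent_mem_causal d.2)
  rw [kernel_eq, pointEval_eq c.2, schurKernel, cauchyKernel_eq d.2, ← hs d]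
  have h := diagPart_resolvent_mul_mul c.2 hS hY
  rw [← hs c] at h
  simp only [mul_sub, sub_mul, mul_one, one_mul, map_sub, mul_assoc] at h ⊢
  rw [h]

end OrientedTree

/-! ### Positivity of the kernel -/

namespace OrientedTree

open TreeL2

variable {V : Type*} {q : ℕ} {T : OrientedTree V q}

/-- Between vectors on one level `diagPart` is invisible, so the adjoints can be moved across the
inner product. -/
theorem inner_kernel (s : T.ball → T.constants) (c d : T.ball) {n : ℤ} {v w : TreeL2 V}
    (hv : T.levelProj n v = v) (hw : T.levelProj n w = w) :
    inner ℂ v (T.kernel s c d w) =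
      inner ℂ (star (T.resolvent c) v) (star (T.resolvent d) w) -
        inner ℂ (star (s c : TreeOp V) (star (T.resolvent c) v))
          (star (s d : TreeOp V) (star (T.resolvent d) w)) := by
  have h1 : T.kernel s c d w = T.levelProj n ((T.resolvent c *
      (1 - (s c : TreeOp V) * star (s d : TreeOp V)) * star (T.resolvent d)) w) := by
    conv_lhs => rw [← hw, ← mul_apply_eq_comp, kernel_eq, diagPart_mul_levelProj]
    rw [mul_apply_eq_comp, hw, mul_apply_eq_comp]
  rw [h1, ← T.star_levelProj, inner_star_right, hv, mul_sub, sub_mul, mul_one,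
    sub_apply, inner_sub_right]
  simp only [mul_apply_eq_comp, inner_star_left]

theorem sum_inner_kernel (s : T.ball → T.constants) {ι : Type*} (F : Finset ι) (c : ι → T.ball)
    {n : ℤ} {v : ι → TreeL2 V} (hv : ∀ i, T.levelProj n (v i) = v i) :
    ∑ i ∈ F, ∑ j ∈ F, inner ℂ (v i) (T.kernel s (c i) (c j) (v j)) =
      ((‖∑ i ∈ F, star (T.resolvent (c i)) (v i)‖ ^ 2 -
        ‖∑ i ∈ F, star (s (c i) : TreeOp V) (star (T.resolvent (c i)) (v i))‖ ^ 2 : ℝ) : ℂ) := by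
  simp only [inner_kernel s _ _ (hv _) (hv _), Finset.sum_sub_distrib]
  push_cast
  have h (g : ι → TreeL2 V) : ∑ i ∈ F, ∑ j ∈ F, inner ℂ (g i) (g j) =
      ((‖∑ i ∈ F, g i‖ : ℝ) : ℂ) ^ 2 := by
    have := inner_self_eq_norm_sq_to_K (𝕜 := ℂ) (∑ i ∈ F, g i)
    rw [sum_inner] at this
    simp only [inner_sum] at this
    exact this
  rw [h, h]

theorem levelProjGE_star_mul_star_resolvent {S : TreeOp V} (hS : S ∈ T.causal)
    {c : Fin q → TreeOp V} (hc : c ∈ T.ball) {n : ℤ} {v : TreeL2 V} (hv : T.levelProj n v = v) :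
    T.levelProjGE n (star S (star (T.resolvent c) v)) =
      star (T.pointEval S c) (star (T.resolvent c) v) := by
  have h1 := congrArg star (levelProj_resolvent_mul_levelProjGE hc hS n)
  simp only [star_mul, T.star_levelProj, T.star_levelProjGE] at h1
  have h2 := congrArg (fun X : TreeOp V => X v) h1
  simp only [mul_apply_eq_comp, hv] at h2
  rw [h2]
  have hcs : star (T.pointEval S c) * star (T.resolvent c) ∈ T.causal := by
    refine causal_mul ?_ (star_resolvent_mem_causal hc)
    rw [pointEval_eq hc]
    exact (mem_constants.2 (hasDegree_diagPart _)).2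
  -- The right side already lives on levels `≥ n` by causality, so the projection in front of it can
  -- be dropped.
  have h3 := congrArg (fun X : TreeOp V => X v) (T.causal_iff.1 hcs n)
  have h4 : T.levelProjGE n v = v := by
    rw [← hv, ← mul_apply_eq_comp, T.levelProjGE_mul_levelProj le_rfl]
  simpa only [mul_apply_eq_comp, h4] using h3

theorem norm_sum_le_of_schurMultiplier {s : T.ball → T.constants} {S : TreeOp V}
    (hS : S ∈ T.schurMultipliers) (hs : ∀ c : T.ball, (s c : TreeOp V) = T.pointEval S c)
    {ι : Type*} (F : Finset ι) (c : ι → T.ball) {n : ℤ} {v : ι → TreeL2 V}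
    (hv : ∀ i, T.levelProj n (v i) = v i) :
    ‖∑ i ∈ F, star (s (c i) : TreeOp V) (star (T.resolvent (c i)) (v i))‖ ≤
      ‖∑ i ∈ F, star (T.resolvent (c i)) (v i)‖ := by
  simp only [hs, ← levelProjGE_star_mul_star_resolvent hS.1 (c _).2 (hv _), ← map_sum]
  refine ((T.levelProjGE n).le_of_opNorm_le (norm_proj_le _) _).trans ?_
  rw [one_mul]
  refine ((star S).le_of_opNorm_le ((norm_star_op S).trans_le hS.2) _).trans ?_
  rw [one_mul]

theorem summable_inner_constantsHS (K : TreeOp V) (k l : T.constantsHS) :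
    Summable fun t => inner ℂ ((l : TreeOp V) (basisVec t))
      ((K * (k : TreeOp V)) (basisVec t)) := by
  refine Summable.of_norm_bounded ((k.2.2.add l.2.2).mul_left ‖K‖) fun t => ?_
  refine (norm_inner_le_norm _ _).trans ?_
  have h := K.le_opNorm ((k : TreeOp V) (basisVec t))
  have h1 := norm_nonneg K
  have h2 := norm_nonneg ((l : TreeOp V) (basisVec t))
  have h3 := norm_nonneg ((k : TreeOp V) (basisVec t))
  rw [mul_apply_eq_comp]
  calc ‖(l : TreeOp V) (basisVec t)‖ * ‖K ((k : TreeOp V) (basisVec t))‖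
      ≤ ‖(l : TreeOp V) (basisVec t)‖ * (‖K‖ * ‖(k : TreeOp V) (basisVec t)‖) := by gcongr
    _ = ‖K‖ * (‖(k : TreeOp V) (basisVec t)‖ * ‖(l : TreeOp V) (basisVec t)‖) := by ring
    _ ≤ _ := by
      gcongr
      nlinarith [sq_nonneg (‖(k : TreeOp V) (basisVec t)‖ - ‖(l : TreeOp V) (basisVec t)‖)]

theorem isPositiveKernel_of_schurMultiplier {s : T.ball → T.constants} {S : TreeOp V}
    (hS : S ∈ T.schurMultipliers) (hs : ∀ c : T.ball, (s c : TreeOp V) = T.pointEval S c) :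
    T.IsPositiveKernel (T.kernel s) := by
  intro m c k
  have hsum : ∀ i j, Summable fun t => inner ℂ ((k i : TreeOp V) (basisVec t))
      ((T.kernel s (c i) (c j) * (k j : TreeOp V)) (basisVec t)) :=
    fun i j => summable_inner_constantsHS _ _ _
  simp only [hsInner]
  rw [Finset.sum_congr rfl fun i _ => (Summable.tsum_finsetSum fun j _ => hsum i j).symm,
    ← Summable.tsum_finsetSum fun i _ => summable_sum fun j _ => hsum i j]
  refine tsum_nonneg fun t => ?_
  -- The trace is a sum over `t`, and for each `t` all the columns lie on the level of `t`; hence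
  -- each summand is a difference of squared norms.
  have hv : ∀ i, T.levelProj (T.level t) ((k i : TreeOp V) (basisVec t)) =
      (k i : TreeOp V) (basisVec t) := fun i => by
    have h := congrArg (fun X : TreeOp V => X (basisVec t))
      (mem_constants.1 (k i).2.1 (T.level t))
    simpa [mul_apply_eq_comp, T.levelProj_basisVec] using h.symm
  simp only [mul_apply_eq_comp]
  rw [sum_inner_kernel s Finset.univ c hv, Complex.zero_le_real, sub_nonneg]
  gcongr
  exact norm_sum_le_of_schurMultiplier hS hs _ c hv

/-- These operators turn positivity against `C₂` into an inequality for arbitrary vectors on one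
level. -/
theorem rankOne_mem_constantsHS {t : V} {v : TreeL2 V} (hv : T.levelProj (T.level t) v = v) :
    InnerProductSpace.rankOne ℂ v (basisVec t) ∈ T.constantsHS := by
  refine ⟨mem_constants.2 fun k => ContinuousLinearMap.ext fun f => ?_, ?_⟩
  · simp only [mul_apply_eq_comp, InnerProductSpace.rankOne_apply, inner_basisVec_left, map_smul,
      add_zero, T.levelProj_apply]
    split_ifs with h
    · rw [← h, hv]
    · rw [← hv, ← mul_apply_eq_comp, T.levelProj_mul_of_ne (Ne.symm h)]
      simp
  · refine (hasSum_single t fun u hu => ?_).summable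
    simp [InnerProductSpace.rankOne_apply, inner_basisVec_left, basisVec_of_ne hu.symm]

theorem IsPositiveKernel.norm_sum_le {s : T.ball → T.constants}
    (h : T.IsPositiveKernel (T.kernel s)) {m : ℕ} (c : Fin (m + 1) → T.ball) {n : ℤ}
    {v : Fin (m + 1) → TreeL2 V} (hv : ∀ i, T.levelProj n (v i) = v i) :
    ‖∑ i, star (s (c i) : TreeOp V) (star (T.resolvent (c i)) (v i))‖ ≤
      ‖∑ i, star (T.resolvent (c i)) (v i)‖ := by
  by_cases hn : ∃ t, T.level t = n
  · obtain ⟨t, rfl⟩ := hn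
    have h1 := h m c fun i => ⟨_, rankOne_mem_constantsHS (hv i)⟩
    have h2 : ∀ i j, hsInner (T.kernel s (c i) (c j) *
        InnerProductSpace.rankOne ℂ (v j) (basisVec t))
        (InnerProductSpace.rankOne ℂ (v i) (basisVec t)) =
        inner ℂ (v i) (T.kernel s (c i) (c j) (v j)) := fun i j => by
      rw [hsInner, tsum_eq_single t fun u hu => ?_]
      · simp [mul_apply_eq_comp, InnerProductSpace.rankOne_apply, norm_basisVec]
      · simp [InnerProductSpace.rankOne_apply, inner_basisVec_left, basisVec_of_ne hu.symm]
    simp only [h2] at h1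
    rw [sum_inner_kernel s Finset.univ c hv, Complex.zero_le_real, sub_nonneg] at h1
    exact le_of_sq_le_sq h1 (norm_nonneg _)
  · have h0 : ∀ i, v i = 0 := fun i => by
      rw [← hv i]
      refine lp.ext (funext fun t => ?_)
      rw [T.levelProj_apply, if_neg fun h => hn ⟨t, h⟩]
      rfl
    simp [h0]

theorem IsPositiveKernel.norm_finsuppSum_le {s : T.ball → T.constants}
    (h : T.IsPositiveKernel (T.kernel s)) (n : ℤ) (a : T.ball →₀ TreeL2 V) :
    ‖a.sum fun c v => star (s c : TreeOp V) (star (T.resolvent c) (T.levelProj n v))‖ ≤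
      ‖a.sum fun c v => star (T.resolvent c) (T.levelProj n v)‖ := by
  -- Positivity is phrased for families indexed by `Fin (m + 1)`, so the empty family is treated
  -- separately.
  rcases Nat.eq_zero_or_eq_succ_pred a.support.card with h0 | h0
  · rw [Finset.card_eq_zero] at h0
    simp [Finsupp.sum, h0]
  · let e := (a.support.equivFinOfCardEq h0).symm
    have hsum : ∀ f : T.ball → TreeL2 V, ∑ i, f (e i) = ∑ c ∈ a.support, f c := fun f => by
      rw [e.sum_comp fun x => f x, Finset.sum_coe_sort]
    have h1 := h.norm_sum_le (fun i => (e i : T.ball)) (n := n)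
      (v := fun i => T.levelProj n (a (e i))) fun i => by
        rw [← mul_apply_eq_comp, T.levelProj_mul_self]
    rwa [hsum fun c => star (s c : TreeOp V) (star (T.resolvent c) (T.levelProj n (a c))),
      hsum fun c => star (T.resolvent c) (T.levelProj n (a c))] at h1

end OrientedTree

/-! ### The multiplier defined by a positive kernel -/

namespace OrientedTree

open TreeL2

variable {V : Type*} {q : ℕ} {T : OrientedTree V q}

/-- Take `c_j = Z α_j^*`, which works because `∑ α_j^* α_j = 1`. Gelfand's formula supplies the
limit, namely the spectral radius, which is at most `‖Z‖`. -/
theorem exists_mem_ball {Z : TreeOp V} (hZ : T.HasDegree Z (-1)) (hn : ‖Z‖ < 1) :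
    ∃ c ∈ T.ball, T.rowShift c = Z := by
  have hrow : T.rowShift (fun j => Z * star (T.shiftOp j)) = Z := by
    simp only [rowShift, mul_assoc, ← Finset.mul_sum, T.sum_star_shiftOp_mul, mul_one]
  refine ⟨_, ⟨fun j => mem_constants.2 ?_, (spectralRadius ℂ Z).toReal, ?_⟩, hrow⟩
  · simpa using hZ.mul (T.hasDegree_shiftOp j).star
  have hlim := spectrum.pow_norm_pow_one_div_tendsto_nhds_spectralRadius Z
  have hle : spectralRadius ℂ Z ≤ ENNReal.ofReal ‖Z‖ := by
    refine le_of_tendsto hlim ?_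
    filter_upwards [Filter.eventually_gt_atTop 0] with n hn0
    refine ENNReal.ofReal_le_ofReal ?_
    calc ‖Z ^ n‖ ^ (1 / (n : ℝ)) ≤ (‖Z‖ ^ n) ^ (1 / (n : ℝ)) := by
          gcongr
          exact norm_pow_le' Z hn0
      _ = ‖Z‖ := by rw [one_div, Real.pow_rpow_inv_natCast (norm_nonneg _) hn0.ne']
  have htop : spectralRadius ℂ Z ≠ ⊤ := ne_top_of_le_ne_top ENNReal.ofReal_ne_top hle
  refine ⟨(ENNReal.toReal_le_of_le_ofReal (norm_nonneg _) hle).trans_lt hn, ?_⟩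
  rw [hrow]
  refine ((ENNReal.tendsto_toReal htop).comp hlim).congr fun n => ?_
  exact ENNReal.toReal_ofReal (Real.rpow_nonneg (norm_nonneg _) _)

/-! ### Density of the Cauchy kernel vectors -/

variable (T)

theorem sum_shiftOp_basisVec (t : V) :
    (∑ j, T.shiftOp j) (basisVec t) = basisVec (T.parent t) := by
  classical
  obtain ⟨i, hi⟩ := T.exists_shift_parent t
  simp only [sum_apply, T.shiftOp_basisVec]
  rw [Finset.sum_eq_single i]
  · rw [if_pos hi]
  · intro j _ hj
    rw [if_neg]
    exact fun h => hj (T.shift_index_injective (T.parent t) (h.trans hi.symm))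
  · simp

theorem level_iterate_parent (k : ℕ) (t : V) : T.level (T.parent^[k] t) = T.level t - k := by
  induction k with
  | zero => simp
  | succ k ih =>
    rw [Function.iterate_succ_apply', T.level_parent, ih]
    push_cast
    ring

theorem iterate_parent_injective (t : V) : Function.Injective fun k => T.parent^[k] t := by
  intro k l h
  have := congrArg T.level h
  simp only [T.level_iterate_parent] at this
  omega

/-- The truncated geometric series along the path from the `m`-th ancestor of `t` to `t`. -/
noncomputable def pathVec (ε : ℂ) (m : ℕ) (t : V) : TreeL2 V :=
  ∑ k ∈ Finset.range (m + 1), ε ^ (m - k) • basisVec (T.parent^[k] t)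

theorem pathVec_zero (ε : ℂ) (t : V) : T.pathVec ε 0 t = basisVec t := by simp [pathVec]

theorem pathVec_succ (ε : ℂ) (m : ℕ) (t : V) :
    T.pathVec ε (m + 1) t = T.pathVec ε m (T.parent t) + ε ^ (m + 1) • basisVec t := by
  simp [pathVec, Finset.sum_range_succ' _ (m + 1)]

theorem exists_star_resolvent_eq_pathVec (m : ℕ) (t : V) :
    ∃ c ∈ T.ball, star (T.resolvent c) (basisVec (T.parent^[m] t)) =
      T.pathVec ((q + 1 : ℝ)⁻¹ : ℝ) m t := by
  classical
  -- Since `‖∑ α_j‖ ≤ q`, this value makes `ε (∑ α_j)` a strict contraction.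
  set ε : ℝ := (q + 1 : ℝ)⁻¹ with hε
  have hε0 : 0 ≤ ε := by positivity
  -- The path from `t` up to, but not including, its `m`-th ancestor. Cutting to `M` makes `star Z`
  -- a weighted shift down this path that stops at `t`, so the series for `star (T.resolvent c)` on
  -- the ancestor is finite.
  let M : Set V := {s | ∃ k < m, T.parent^[k] t = s}
  let Z : TreeOp V := (ε : ℂ) • ((∑ j, T.shiftOp j) * proj M)
  have hdeg : T.HasDegree Z (-1) := fun k => by
    have h := (HasDegree.sum (F := Finset.univ) fun j _ => T.hasDegree_shiftOp j).mul
      (T.hasDegree_proj M) k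
    rw [add_zero] at h
    simp only [Z, smul_mul_assoc, mul_smul_comm, h]
  have hnorm : ‖Z‖ < 1 := by
    have h1 : ‖∑ j, T.shiftOp j‖ ≤ q := by
      refine (norm_sum_le _ _).trans ?_
      refine (Finset.sum_le_sum fun j _ => norm_compOp_le (T.shift j) (T.shift_injective j)).trans ?_
      simp
    calc ‖Z‖ ≤ ε * (‖∑ j, T.shiftOp j‖ * ‖proj M‖) := by
          refine (norm_smul_le (ε : ℂ) ((∑ j, T.shiftOp j) * proj M)).trans ?_
          rw [Complex.norm_real, Real.norm_of_nonneg hε0]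
          gcongr
          exact norm_mul_le _ _
      _ ≤ ε * (q * 1) := by
          gcongr
          exact norm_proj_le M
      _ < 1 := by
          rw [hε, mul_one, inv_mul_lt_iff₀ (by positivity)]
          linarith
  obtain ⟨c, hc, hcZ⟩ := exists_mem_ball hdeg hnorm
  refine ⟨c, hc, ?_⟩
  have hstar : ∀ (f : TreeL2 V) (u : V), star Z f u = if u ∈ M then ε * f (T.parent u) else 0 := by
    intro f u
    rw [← inner_basisVec_left, inner_star_right]
    simp only [Z, smul_apply, mul_apply_eq_comp, proj_basisVec]
    split_ifs with h
    · rw [T.sum_shiftOp_basisVec, inner_smul_left, inner_basisVec_left, Complex.conj_ofReal]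
    · simp
  have h0 : star Z (basisVec t) = 0 := by
    refine lp.ext (funext fun u => ?_)
    rw [hstar]
    split_ifs with h
    · obtain ⟨k, hk, rfl⟩ := h
      rw [← Function.iterate_succ_apply' T.parent k t, basisVec_of_ne, mul_zero]
      · rfl
      · exact fun h => absurd (T.iterate_parent_injective t (a₁ := k + 1) (a₂ := 0) h) (by omega)
    · rfl
  have hs : ∀ k < m, star Z (basisVec (T.parent^[k + 1] t)) =
      (ε : ℂ) • basisVec (T.parent^[k] t) := by
    intro k hk
    refine lp.ext (funext fun u => ?_)
    rw [hstar, lp.coeFn_smul, Pi.smul_apply, smul_eq_mul]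
    by_cases hu : u = T.parent^[k] t
    · subst hu
      rw [if_pos ⟨k, hk, rfl⟩, ← Function.iterate_succ_apply' T.parent k t, basisVec_self, basisVec_self]
    · rw [basisVec_of_ne hu, mul_zero]
      split_ifs with h
      · obtain ⟨i, hi, rfl⟩ := h
        rw [← Function.iterate_succ_apply' T.parent i t, basisVec_of_ne, mul_zero]
        intro h
        have : i + 1 = k + 1 := T.iterate_parent_injective t h
        exact hu (by rw [Nat.succ_injective this])
      · rfl
  have key : (1 - star Z) (T.pathVec ε m t) = basisVec (T.parent^[m] t) := by
    have h1 : star Z (T.pathVec ε m t) =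
        ∑ k ∈ Finset.range m, (ε : ℂ) ^ (m - k) • basisVec (T.parent^[k] t) := by
      rw [pathVec, map_sum, Finset.sum_range_succ']
      simp only [map_smul, Function.iterate_zero, id_eq, h0, smul_zero, add_zero]
      refine Finset.sum_congr rfl fun k hk => ?_
      have hk' := Finset.mem_range.1 hk
      rw [hs k hk', smul_smul, ← pow_succ]
      congr 2
      omega
    rw [sub_apply, h1, pathVec, Finset.sum_range_succ]
    simp
  have h1 := congrArg star (one_sub_mul_resolvent hc)
  simp only [star_mul, star_sub, star_one, hcZ] at h1
  rw [← key, ← mul_apply_eq_comp, h1]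
  rfl

theorem basisVec_mem_of_star_resolvent_mem {n : ℤ} {K : Submodule ℂ (TreeL2 V)}
    (hK : ∀ (c : T.ball) (v : TreeL2 V), star (T.resolvent c) (T.levelProj n v) ∈ K)
    (hlow : ∀ t, T.level t < n → basisVec t ∈ K) (t : V) : basisVec t ∈ K := by
  set ε : ℝ := (q + 1 : ℝ)⁻¹ with hε
  have hpath : ∀ (m : ℕ) (t : V), T.level t = n + m → T.pathVec ε m t ∈ K := by
    intro m t ht
    obtain ⟨c, hc, h⟩ := T.exists_star_resolvent_eq_pathVec m t
    rw [← h]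
    have := hK ⟨c, hc⟩ (basisVec (T.parent^[m] t))
    rwa [T.levelProj_basisVec, if_pos (by rw [T.level_iterate_parent]; omega)] at this
  rcases lt_or_ge (T.level t) n with h | h
  · exact hlow t h
  obtain ⟨m, hm⟩ := Int.le.dest h
  cases m with
  | zero =>
    have := hpath 0 t (by omega)
    rwa [T.pathVec_zero] at this
  | succ m =>
    have h1 := hpath (m + 1) t (by omega)
    have h2 := hpath m (T.parent t) (by rw [T.level_parent]; push_cast at hm; omega)
    rw [T.pathVec_succ] at h1
    -- The path to `t` and the path to its parent start at the same node of level `n`; their series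
    -- differ only in the last term, a nonzero multiple of `χ_t`.
    have h3 := (K.add_mem_iff_right h2).1 h1
    have hε0 : (ε : ℂ) ^ (m + 1) ≠ 0 := by
      refine pow_ne_zero _ (Complex.ofReal_ne_zero.2 ?_)
      positivity
    exact (K.smul_mem_iff hε0).1 h3

/-! ### From a positive kernel to a multiplier -/

variable {T}

theorem op_ext_of_star_resolvent {n : ℤ} {X Y : TreeOp V}
    (h : ∀ c : T.ball, X * star (T.resolvent c) * T.levelProj n =
      Y * star (T.resolvent c) * T.levelProj n)
    (hlow : ∀ t, T.level t < n → X (basisVec t) = Y (basisVec t)) : X = Y :=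
  op_ext <| T.basisVec_mem_of_star_resolvent_mem (n := n)
    (K := LinearMap.eqLocus (X : TreeL2 V →ₗ[ℂ] TreeL2 V) (Y : TreeL2 V →ₗ[ℂ] TreeL2 V))
    (fun c v => congrArg (fun Z : TreeOp V => Z v) (h c)) hlow

/-- The first `m` terms of `R_c^*` send level `n` to levels below `n + m` and are cut off. The rest
is again a Cauchy kernel, now started on level `n + m`; this links the contractions for different
`n`. -/
theorem levelProjGE_mul_star_resolvent {c : Fin q → TreeOp V} (hc : c ∈ T.ball) (n : ℤ) (m : ℕ) :
    T.levelProjGE (n + m) * star (T.resolvent c) * T.levelProj n =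
      star (T.resolvent c) * T.levelProj (n + m) * star (T.rowShift c ^ m) := by
  have hP : ∀ i : ℕ, star (T.rowShift c ^ i) * T.levelProj n =
      T.levelProj (n + i) * star (T.rowShift c ^ i) := fun i =>
    hasDegree_star_rowShift_pow hc i n
  have hstar := congrArg star (resolvent_eq_sum_add hc m)
  rw [star_add, star_sum, star_mul] at hstar
  conv_lhs => rw [hstar]
  rw [mul_add, add_mul, Finset.mul_sum, Finset.sum_mul, Finset.sum_eq_zero, zero_add]
  · have h1 := T.causal_iff.1 (star_resolvent_mem_causal hc) (n + m)
    rw [mul_assoc, mul_assoc, hP, ← T.levelProjGE_mul_levelProj (le_refl (n + (m : ℤ)))]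
    simp only [← mul_assoc, h1]
  · intro i hi
    have hi' := Finset.mem_range.1 hi
    have h0 : T.levelProjGE (n + m) * T.levelProj (n + i) = 0 := by
      simpa [T.star_levelProj, T.star_levelProjGE] using
        congrArg star (T.levelProj_mul_levelProjGE_of_lt (k := n + i) (n := n + m) (by omega))
    rw [mul_assoc, hP, ← mul_assoc, h0, zero_mul]

theorem levelProjGE_mul_constant {X : TreeOp V} (hX : X ∈ T.constants) (n : ℤ) :
    T.levelProjGE n * X = X * T.levelProjGE n := by
  have h1 := T.causal_iff.1 hX.1 n
  have h2 := congrArg star (T.causal_iff.1 hX.2 n)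
  simp only [star_mul, star_star, T.star_levelProjGE] at h2
  rw [mul_assoc] at h1
  exact h2.symm.trans h1

/-- A positive kernel defines a contraction on the functions supported on the levels from `n`
on. -/
theorem IsPositiveKernel.exists_contraction {s : T.ball → T.constants}
    (h : T.IsPositiveKernel (T.kernel s)) (n : ℤ) :
    ∃ A : TreeOp V, ‖A‖ ≤ 1 ∧ A * T.levelProjGE n = A ∧ ∀ c : T.ball,
      A * star (T.resolvent c) * T.levelProj n =
        star (s c : TreeOp V) * star (T.resolvent c) * T.levelProj n := by
  -- The second coordinate supplies the functions below level `n`, which makes the range of `X`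
  -- dense in the whole space; `Y` is zero there. The contraction is the extension of `X x ↦ Y x`.
  let X : (T.ball →₀ TreeL2 V) × TreeL2 V →ₗ[ℂ] TreeL2 V :=
    (Finsupp.lsum ℂ fun c : T.ball => ((star (T.resolvent c) * T.levelProj n : TreeOp V) :
      TreeL2 V →ₗ[ℂ] TreeL2 V)).coprod ((1 - T.levelProjGE n : TreeOp V) :
      TreeL2 V →ₗ[ℂ] TreeL2 V)
  let Y : (T.ball →₀ TreeL2 V) × TreeL2 V →ₗ[ℂ] TreeL2 V :=
    (Finsupp.lsum ℂ fun c : T.ball => ((star (s c : TreeOp V) * star (T.resolvent c) *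
      T.levelProj n : TreeOp V) : TreeL2 V →ₗ[ℂ] TreeL2 V)).coprod 0
  have hXc : ∀ (c : T.ball) v, X (Finsupp.single c v, 0) =
      star (T.resolvent c) (T.levelProj n v) := fun c v => by simp [X]
  have hYc : ∀ (c : T.ball) v, Y (Finsupp.single c v, 0) =
      star (s c : TreeOp V) (star (T.resolvent c) (T.levelProj n v)) := fun c v => by
    simp [Y]
  have hXf : ∀ f, X (0, f) = f - T.levelProjGE n f := fun f => by simp [X]
  have hYf : ∀ f, Y (0, f) = 0 := fun f => by simp [Y]
  have hdense : DenseRange X := by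
    refine mem_of_basisVec_mem (K := LinearMap.range X) ?_
    refine T.basisVec_mem_of_star_resolvent_mem (n := n) (fun c v => ⟨_, hXc c v⟩)
      fun t ht => ⟨(0, basisVec t), ?_⟩
    rw [hXf, T.levelProjGE_basisVec, if_neg (by omega), sub_zero]
  have hbound : ∀ x, ‖Y x‖ ≤ 1 * ‖X x‖ := by
    rintro ⟨a, f⟩
    have hY : Y (a, f) = a.sum fun c v =>
        star (s c : TreeOp V) (star (T.resolvent c) (T.levelProj n v)) := by
      simp [Y, Finsupp.lsum_apply]
      rfl
    have hX : X (a, f) = (a.sum fun c v => star (T.resolvent c) (T.levelProj n v)) +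
        (f - T.levelProjGE n f) := by
      simp [X, Finsupp.lsum_apply]
      rfl
    -- The two parts of `X (a, f)` have disjoint supports, so the first has norm at most that of the
    -- whole.
    have hproj : T.levelProjGE n (X (a, f)) =
        a.sum fun c v => star (T.resolvent c) (T.levelProj n v) := by
      have h0 : ∀ g, T.levelProjGE n (T.levelProjGE n g) = T.levelProjGE n g := fun g => by
        rw [← mul_apply_eq_comp, T.levelProjGE_mul_levelProjGE le_rfl]
      rw [hX, map_add, map_sub, h0, sub_self, add_zero, map_finsuppSum]
      refine Finsupp.sum_congr fun c _ => ?_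
      have := congrArg (fun Z : TreeOp V => Z (a c)) (levelProjGE_mul_star_resolvent c.2 n 0)
      simpa [mul_apply_eq_comp] using this
    rw [hY]
    refine (h.norm_finsuppSum_le n a).trans ?_
    rw [← hproj]
    exact (T.levelProjGE n).le_of_opNorm_le (norm_proj_le _) _
  have hA : ∀ x, Y.extendOfNorm X (X x) = Y x := LinearMap.extendOfNorm_eq hdense ⟨1, hbound⟩
  refine ⟨Y.extendOfNorm X, LinearMap.opNorm_extendOfNorm_le hdense zero_le_one hbound,
    ContinuousLinearMap.ext fun f => ?_, fun c => ContinuousLinearMap.ext fun v => ?_⟩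
  · have := hA (0, f)
    rw [hXf, hYf, map_sub, sub_eq_zero] at this
    exact this.symm
  · have := hA (Finsupp.single c v, 0)
    rwa [hXc, hYc] at this

theorem IsPositiveKernel.exists_schurMultiplier {s : T.ball → T.constants}
    (h : T.IsPositiveKernel (T.kernel s)) :
    ∃ S ∈ T.schurMultipliers, ∀ c : T.ball, (s c : TreeOp V) = T.pointEval S c := by
  choose A hA1 hAn hA using h.exists_contraction
  -- Compatibility is tested on the vectors `R_c^* v` with `v` on level `n`, where both sides give
  -- `s(c)^*` applied to the part on levels `≥ n + m`; on basis vectors below level `n` both vanish.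
  have hcomm : ∀ n (m : ℕ), T.levelProjGE (n + m) * A n = A (n + m) * T.levelProjGE (n + m) := by
    intro n m
    refine op_ext_of_star_resolvent (T := T) (n := n) (fun c => ?_) fun t ht => ?_
    · have hs : T.levelProjGE (n + m) * star (s c : TreeOp V) =
          star (s c : TreeOp V) * T.levelProjGE (n + m) :=
        levelProjGE_mul_constant ⟨(s c).2.2, by simpa using (s c).2.1⟩ _
      have h1 := levelProjGE_mul_star_resolvent c.2 n m
      calc T.levelProjGE (n + m) * A n * star (T.resolvent c) * T.levelProj n
          = T.levelProjGE (n + m) * (A n * star (T.resolvent c) * T.levelProj n) := by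
            simp only [mul_assoc]
        _ = star (s c : TreeOp V) *
            (T.levelProjGE (n + m) * star (T.resolvent c) * T.levelProj n) := by
            rw [hA]
            simp only [← mul_assoc, hs]
        _ = A (n + m) * (T.levelProjGE (n + m) * star (T.resolvent c) * T.levelProj n) := by
            rw [h1]
            simp only [← mul_assoc, hA]
        _ = _ := by simp only [mul_assoc]
    · rw [← hAn n]
      simp only [mul_apply_eq_comp, T.levelProjGE_basisVec]
      rw [if_neg (by omega), if_neg (by omega)]
      simp
  have hBn : ∀ n, T.levelProjGE n * star (A n) = star (A n) := fun n => by
    simpa [T.star_levelProjGE] using congrArg star (hAn n)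
  have hB : ∀ n (m : ℕ), star (A n) * T.levelProjGE (n + m) = star (A (n + m)) := fun n m => by
    rw [← hBn (n + m)]
    simpa [T.star_levelProjGE] using congrArg star (hcomm n m)
  -- Any `A n` starting at or below the level of `t` determines the same column at `t`, so the
  -- columns define one operator.
  have hBt : ∀ n t, n ≤ T.level t →
      star (A (T.level t)) (basisVec t) = star (A n) (basisVec t) := by
    intro n t ht
    obtain ⟨m, hm⟩ := Int.le.dest ht
    rw [← hm, ← hB, mul_apply_eq_comp, T.levelProjGE_basisVec, if_pos hm.le]
  let e : (V →₀ ℂ) →ₗ[ℂ] TreeL2 V := Finsupp.linearCombination ℂ basisVec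
  let f : (V →₀ ℂ) →ₗ[ℂ] TreeL2 V :=
    Finsupp.linearCombination ℂ fun t => star (A (T.level t)) (basisVec t)
  have hdense : DenseRange e := mem_of_basisVec_mem (K := LinearMap.range e) fun t =>
    ⟨Finsupp.single t 1, by simp [e]⟩
  have hbound : ∀ a, ‖f a‖ ≤ 1 * ‖e a‖ := by
    intro a
    -- A finite support has a lower bound for its levels, so one contraction `star (A n)` handles
    -- the whole combination.
    obtain ⟨n, hn⟩ := (a.support.finite_toSet.image T.level).bddBelow
    have hf : f a = star (A n) (e a) := by
      simp only [f, e, Finsupp.linearCombination_apply, map_finsuppSum, map_smul]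
      exact Finsupp.sum_congr fun t ht => by rw [hBt n t (hn (Set.mem_image_of_mem _ ht))]
    rw [hf]
    exact (star (A n)).le_of_opNorm_le ((norm_star_op _).trans_le (hA1 n)) _
  have hS : ∀ n, f.extendOfNorm e * T.levelProjGE n = star (A n) := by
    intro n
    refine op_ext fun t => ?_
    rw [mul_apply_eq_comp, T.levelProjGE_basisVec]
    split_ifs with ht
    · have := LinearMap.extendOfNorm_eq hdense ⟨1, hbound⟩ (Finsupp.single t 1)
      simp only [e, f, Finsupp.linearCombination_single, one_smul] at this
      rw [this, hBt n t ht]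
    · have h0 := hB n 0
      rw [Nat.cast_zero, add_zero] at h0
      rw [← h0, mul_apply_eq_comp, T.levelProjGE_basisVec, if_neg ht, map_zero, map_zero]
  refine ⟨f.extendOfNorm e, ⟨T.causal_iff.2 fun n => ?_,
    LinearMap.opNorm_extendOfNorm_le hdense zero_le_one hbound⟩, fun c => ?_⟩
  · rw [mul_assoc, hS, hBn]
  · refine T.levelProj_ext_right fun n => ?_
    have hs := mem_constants.1 (s c).2
    have h1 : (s c : TreeOp V) = T.diagPart (T.resolvent c * s c) := by
      rw [diagPart_mul_right hs, diagPart_resolvent c.2, one_mul]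
    have h2 := congrArg star (hA n c)
    -- The adjoint of the defining property of `A n`: in front of level `n`, `R_c A_n^*` equals `R_c
    -- s(c)`, whose diagonal block is that of `s(c)`.
    simp only [star_mul, star_star, T.star_levelProj] at h2
    have h3 : star (A n) * T.levelProj n = f.extendOfNorm e * T.levelProj n := by
      rw [← hS, mul_assoc, T.levelProjGE_mul_levelProj le_rfl]
    calc (s c : TreeOp V) * T.levelProj n
        = T.levelProj n * (T.resolvent c * s c) * T.levelProj n := by
          conv_lhs => rw [h1, diagPart_mul_levelProj]
      _ = T.levelProj n * T.resolvent c * (star (A n) * T.levelProj n) := by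
          rw [← h2]
          simp only [mul_assoc]
      _ = T.levelProj n * (T.resolvent c * f.extendOfNorm e) * T.levelProj n := by
          rw [h3]
          simp only [mul_assoc]
      _ = T.pointEval (f.extendOfNorm e) c * T.levelProj n := by
          rw [pointEval_eq c.2, diagPart_mul_levelProj]

end OrientedTree

theorem theorem6p1 {V : Type*} {q : ℕ} (hq : 1 ≤ q) (T : OrientedTree V q)
    (s : T.ball → T.constants) :
    (∀ c d : T.ball, (Summable fun n => ‖T.kernelTerm s c d n‖) ∧
      T.kernel s c d ∈ T.constants) ∧
    ((∃ S ∈ T.schurMultipliers, ∀ c : T.ball, (s c : TreeOp V) = T.pointEval S c) ↔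
      T.IsPositiveKernel (T.kernel s)) ∧
    (∀ S ∈ T.schurMultipliers, (∀ c : T.ball, (s c : TreeOp V) = T.pointEval S c) →
      ∀ c d : T.ball, IsUnit (1 - star (T.rowShift d)) ∧ T.schurKernel S d ∈ T.causal ∧
        T.kernel s c d = T.pointEval (T.schurKernel S d) c) :=
  ⟨fun c d => ⟨OrientedTree.summable_norm_kernelTerm s c d,
      OrientedTree.kernel_mem_constants s c d⟩,
    ⟨fun ⟨_, hS, hs⟩ => OrientedTree.isPositiveKernel_of_schurMultiplier hS hs,
      fun h => OrientedTree.IsPositiveKernel.exists_schurMultiplier h⟩,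
    fun _ hS hs c d => ⟨OrientedTree.isUnit_one_sub_star d.2,
      OrientedTree.schurKernel_mem_causal hS.1 d.2, OrientedTree.kernel_eq_pointEval hS.1 hs c d⟩⟩
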